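/- A tropical plane curve is a finite nonempty weighted one-dimensional complex $L\subset\mathbb{R}^2$ whose edges (segments, rays or lines of rational slope) have positive integer weights and meet only in common endpoints, and which is balanced: at each vertex $V$ one has $\sum_{E\ni V}\operatorname{wt}(E)\,u_E=0$, where $u_E$ is the primitive integer vector of $E$ starting at $V$. Subdivisions are disregarded, i.e. every vertex lies on at least three edges. A Newton complex of $L$ assigns to each connected component $U_i$ of $\mathbb{R}^2\setminus L$ a point $w_i\in\mathbb{Z}^2$ such that, whenever $U_i$ and $U_j$ lie on the two sides of an edge $E$, $w_j-w_i=\operatorname{wt}(E)\,n$ with $n$ the primitive integer vector orthogonal to $E$ pointing from $U_i$ to $U_j$. The Newton polygon $\Delta(L)=\operatorname{Conv}\{w_i\}$ is defined up to translation. For a tropical curve $L$, let $\overline{\mathcal{P}}_L$ be the closed cone of all maps $\varphi\colon L\to\mathbb{R}^2$ that, on each finite edge, preserve the direction and multiply lengths by a factor $a_E\ge 0$, and that, on each infinite edge, are translations. It is given the topology of pointwise convergence; when $L$ has a vertex, the lattice lengths of the images of the finite edges and the position of the image of one vertex are coordinates on it. Each $\varphi\in\overline{\mathcal{P}}_L$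 parametrizes the image tropical curve $\varphi(L)$, in which edges mapped to points are contracted and the weights of overlapping images are added. Let $\mathcal{P}(\mathbb{R}^2)$ be the set of all tropical plane curves with the topology glued from these closed cones: a set of curves is open if and only if its preimage in $\overline{\mathcal{P}}_L$ is open for every $L$. Then two tropical plane curves $L,L'\in\mathcal{P}(\mathbb{R}^2)$ lie in the same connected component of $\mathcal{P}(\mathbb{R}^2)$ if and only if $\Delta(L)=\Delta(L')$ up to translation. -/

import Mathlib

open Filter Topology

/-- The affine plane `ℝ²`. -/
abbrev Plane : Type := ℝ × ℝ

/-- The inclusion `ℤ² → ℝ²`. -/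
def latticeVec (u : ℤ × ℤ) : Plane := ((u.1 : ℝ), (u.2 : ℝ))

/-- A primitive vector: an integral vector with relatively prime coordinates. -/
def IsPrimitiveVec (u : ℤ × ℤ) : Prop := IsCoprime u.1 u.2

/-- The point set of an edge of rational slope: a nondegenerate segment, a ray, or a whole line,
in the direction of a primitive vector. -/
def IsRationalEdge (E : Set Plane) : Prop :=
  ∃ (P : Plane) (u : ℤ × ℤ), IsPrimitiveVec u ∧
    ((∃ l : ℝ, 0 < l ∧ E = (fun t : ℝ => P + t • latticeVec u) '' Set.Icc 0 l) ∨
      E = (fun t : ℝ => P + t • latticeVec u) '' Set.Ici 0 ∨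
      E = Set.range (fun t : ℝ => P + t • latticeVec u))

/-- `u` is the primitive vector of the edge `E` starting at its endpoint `V`. -/
def IsPrimitiveVecAt (V : Plane) (E : Set Plane) (u : ℤ × ℤ) : Prop :=
  IsPrimitiveVec u ∧ ∃ t : ℝ, 0 < t ∧ V + t • latticeVec u ∈ E

open scoped Classical in
/-- A tropical curve in `ℝ²`: a finite nonempty collection of edges of rational slope with positive
integral weights, which form a one-dimensional complex and satisfy the balancing condition at every
vertex. The edges are the sets of nonzero weight; the vertices are the endpoints (extreme points) of
the edges. The complex is the coarsest one, i.e. no vertex merely subdivides an edge, so that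
a curve is determined by its weighted point set and has a unique representation. -/
@[ext] structure TropicalCurve where
  /-- The weight of each edge (zero on all sets which are not edges). -/
  wt : Set Plane →₀ ℕ
  nonempty : wt.support.Nonempty
  isEdge : ∀ E ∈ wt.support, IsRationalEdge E
  /-- Distinct edges meet only in common endpoints. -/
  inter_subset : ∀ E ∈ wt.support, ∀ F ∈ wt.support, E ≠ F →
    E ∩ F ⊆ E.extremePoints ℝ ∩ F.extremePoints ℝ
  /-- The sum of the weighted primitive vectors starting at a vertex is zero. -/
  balanced : ∀ E₀ ∈ wt.support, ∀ V ∈ E₀.extremePoints ℝ,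
    ∃ u : Set Plane → ℤ × ℤ,
      (∀ E ∈ wt.support, V ∈ E → IsPrimitiveVecAt V E (u E)) ∧
      ∑ E ∈ wt.support with V ∈ E, wt E • u E = 0
  /-- Every vertex is at least trivalent (a balanced bivalent vertex only subdivides an edge). -/
  trivalent : ∀ E₀ ∈ wt.support, ∀ V ∈ E₀.extremePoints ℝ,
    3 ≤ (wt.support.filter (fun E => V ∈ E)).card

namespace TropicalCurve

/-- The (finite) set of edges of `L`. -/
def edges (L : TropicalCurve) : Finset (Set Plane) := L.wt.support

/-- The set of vertices of `L`. -/
def vertices (L : TropicalCurve) : Set Plane := {V | ∃ E ∈ L.edges, V ∈ E.extremePoints ℝ}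

/-- The point set of `L`. -/
def carrier (L : TropicalCurve) : Set Plane := {x | ∃ E ∈ L.edges, x ∈ E}

/-! ### Newton polygon -/

/-- The index set of the connected components `U_i` of `ℝ² \ L`. -/
abbrev Region (L : TropicalCurve) : Type := ConnectedComponents ↥(L.carrierᶜ)

/-- The connected component `U_i` of `ℝ² \ L`, as a subset of the plane. -/
def regionSet (L : TropicalCurve) (i : L.Region) : Set Plane :=
  {x | ∃ h : x ∈ L.carrierᶜ, ConnectedComponents.mk (⟨x, h⟩ : ↥(L.carrierᶜ)) = i}

/-- The regions `U_i` and `U_j` lie on the two sides of the edge `E`, and `n` is the primitive vector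
orthogonal to `E` with direction from `U_i` to `U_j`. -/
def IsNormalFromTo (L : TropicalCurve) (E : Set Plane) (i j : L.Region) (n : ℤ × ℤ) : Prop :=
  IsPrimitiveVec n ∧
  (∀ x ∈ E, ∀ y ∈ E, (x.1 - y.1) * (n.1 : ℝ) + (x.2 - y.2) * (n.2 : ℝ) = 0) ∧
  ∃ x ∈ E \ L.vertices, ∀ᶠ t : ℝ in 𝓝[>] 0,
    x - t • latticeVec n ∈ L.regionSet i ∧ x + t • latticeVec n ∈ L.regionSet j

/-- The points `w i ∈ ℤ²` are the vertices of a Newton complex of `L`: whenever the regions `U_i`,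
`U_j` are adjacent along an edge `E`, the vector `w j - w i` has lattice length the weight of `E`, and
is orthogonal to `E`, with direction from `U_i` to `U_j`. (The edges of the Newton complex are the
segments `[w i, w j]` for such pairs of regions.) -/
def IsNewtonComplex (L : TropicalCurve) (w : L.Region → ℤ × ℤ) : Prop :=
  ∀ E ∈ L.edges, ∀ (i j : L.Region) (n : ℤ × ℤ), L.IsNormalFromTo E i j n →
    w j - w i = L.wt E • n

/-- `Δ` is a Newton polygon of `L`, i.e. the convex hull of a Newton complex of `L`. It is unique up
to translation by integral vectors. -/
def IsNewtonPolygon (L : TropicalCurve) (Δ : Set Plane) : Prop :=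
  ∃ w : L.Region → ℤ × ℤ, L.IsNewtonComplex w ∧
    Δ = convexHull ℝ (Set.range fun i => latticeVec (w i))

/-- `Δ(L) = Δ(L')`. As a Newton polygon is only defined up to translation, this says that `L` and `L'`
have a Newton polygon in common. -/
def SameNewtonPolygon (L L' : TropicalCurve) : Prop :=
  ∃ Δ : Set Plane, L.IsNewtonPolygon Δ ∧ L'.IsNewtonPolygon Δ

/-! ### The space of all tropical curves -/

/-- The image of an edge under a map defined on the curve. -/
def edgeImage (L : TropicalCurve) (φ : ↥L.carrier → Plane) (E : Set Plane) : Set Plane :=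
  {y | ∃ x : ↥L.carrier, (x : Plane) ∈ E ∧ φ x = y}

/-- The closed cone of (possibly degenerate) deformations of `L` with fixed edge directions: maps
`φ : L → ℝ²` that keep the direction of each edge `E`, multiply the length of each finite edge by a
factor `a ≥ 0`, and translate each infinite edge. On a curve with at least one vertex `V₀` such a map
is determined, linearly, by the lattice lengths of the images of the finite edges and by `φ V₀`; the
constraints on these numbers are that the lengths be nonnegative and that every cycle of `L` close
up. Then the factors `a > 0` give the curves with the same Newton complex, and `a = 0` means that the
edge is contracted. (A curve without vertices is a union of parallel lines, and `φ` moves each of the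
lines by an arbitrary translation.) The cone carries the topology of pointwise convergence, which is that of these
finitely many coordinates. -/
def closedCone (L : TropicalCurve) : Set (↥L.carrier → Plane) :=
  {φ | ∀ E ∈ L.edges, ∃ a : ℝ, 0 ≤ a ∧ (¬ Bornology.IsBounded E → a = 1) ∧
    ∀ x y : ↥L.carrier, (x : Plane) ∈ E → (y : Plane) ∈ E → φ x - φ y = a • ((x : Plane) - y)}

open scoped Classical in
/-- `L'` is the image of the weighted curve `L` under `φ`: at all but finitely many points of the
plane (the exceptions being vertices, crossings and contracted edges) the weight of `L'` is the sum of
the weights of the edges of `L` whose images pass through that point. -/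
def IsImage (L : TropicalCurve) (φ : ↥L.carrier → Plane) (L' : TropicalCurve) : Prop :=
  {x : Plane | ∑ E ∈ L'.edges with x ∈ E, L'.wt E ≠
    ∑ E ∈ L.edges with x ∈ L.edgeImage φ E, L.wt E}.Finite

/-- The closed cone of `L`, each point of which is taken together with the tropical curve that it
parametrizes. -/
def Cell (L : TropicalCurve) : Type :=
  {x : (↥L.carrier → Plane) × TropicalCurve // x.1 ∈ L.closedCone ∧ L.IsImage x.1 x.2}

/-- The parameter in the closed cone. -/
def Cell.param {L : TropicalCurve} (x : L.Cell) : ↥L.carrier → Plane := x.1.1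

/-- The parametrized curve. -/
def Cell.curve {L : TropicalCurve} (x : L.Cell) : TropicalCurve := x.1.2

/-- The topology of the cell is that of the cone. -/
instance (L : TropicalCurve) : TopologicalSpace L.Cell :=
  TopologicalSpace.induced Cell.param inferInstance

/-- The space `𝒫(ℝ²)` of all tropical plane curves is glued from the closed cones: a set of curves is
open if and only if its preimage in each closed cone is open. -/
instance : TopologicalSpace TropicalCurve :=
  ⨆ L : TropicalCurve, TopologicalSpace.coinduced (Cell.curve (L := L)) inferInstance

end TropicalCurve

/-! The link between the two sides is `endWeight`: for each primitive direction, the total weight of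
the unbounded edges that go to infinity in it. It carries the same information as the Newton
polygon, and it is what stays fixed along a connected component.

End weights and polygon. For a generic direction `ξ`, follow the ray from `x` in the direction `ξ`
and add up, with sign, the weighted normals of the edges crossed; this is `potential`. Balancing
makes it locally constant off the curve (`eventually_sum_shadowTerm_eq`), and it jumps correctly
across edges (`eventually_potential_sub`), so it is a Newton complex. Since the plane without the
vertices is connected, every Newton complex is a translate of it. The region far out along `ξ`
carries the lattice point of the polygon that is extremal in the direction `ξ`. The extremal points
for `ξ` and `v` differ by the rotated sum of the ends in the cone between `ξ` and `v`
(`IsNewtonPolygon.isTop_sub_isTop`). Thus the ends determine all generic extremal points from one of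
them, hence the polygon (`sameNewtonPolygon_of_endWeight_eq`); conversely, narrow cones around
single directions recover the ends (`SameNewtonPolygon.endWeight_eq`).

End weights and components. A map in a closed cone translates the unbounded edges, so all curves of
a cell have the same end weights (`Cell.endWeight_eq`), and the level sets of `endWeight` are
clopen. Conversely, shrinking the bounded edges of `L` to zero is a path in the closed cone of `L`,
from `L` to the union of rays from the origin with the same end weights
(`connectedComponent_eq_of_fan`). That fan depends on the end weights alone; it exists because they
are nonzero and balanced. -/

namespace TropicalCurve

/-! ### Linear algebra in the plane -/

/-- The determinant of two vectors of the plane. -/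
def det (a b : Plane) : ℝ := a.1 * b.2 - a.2 * b.1

/-- The scalar product of two vectors of the plane. -/
def dot (a b : Plane) : ℝ := a.1 * b.1 + a.2 * b.2

/-- Rotation of an integral vector by a right angle. -/
def rot : (ℤ × ℤ) →+ (ℤ × ℤ) where
  toFun u := (-u.2, u.1)
  map_zero' := by simp
  map_add' u v := by ext <;> simp [add_comm]

@[simp] lemma rot_fst (u : ℤ × ℤ) : (rot u).1 = -u.2 := rfl
@[simp] lemma rot_snd (u : ℤ × ℤ) : (rot u).2 = u.1 := rfl

lemma rot_injective : Function.Injective rot := by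
  intro u v h
  have h1 := congrArg Prod.fst h
  have h2 := congrArg Prod.snd h
  simp only [rot_fst, rot_snd] at h1 h2
  exact Prod.ext h2 (by linarith)

@[simp] lemma latticeVec_fst (u : ℤ × ℤ) : (latticeVec u).1 = (u.1 : ℝ) := rfl
@[simp] lemma latticeVec_snd (u : ℤ × ℤ) : (latticeVec u).2 = (u.2 : ℝ) := rfl

@[simp] lemma latticeVec_zero : latticeVec 0 = 0 := by ext <;> simp

@[simp] lemma latticeVec_neg (u : ℤ × ℤ) : latticeVec (-u) = -latticeVec u := by ext <;> simp

lemma latticeVec_add (u v : ℤ × ℤ) : latticeVec (u + v) = latticeVec u + latticeVec v := by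
  ext <;> simp

lemma latticeVec_nsmul (n : ℕ) (u : ℤ × ℤ) : latticeVec (n • u) = (n : ℝ) • latticeVec u := by
  ext <;> simp

lemma latticeVec_injective : Function.Injective latticeVec := by
  intro u v h
  have h1 := congrArg Prod.fst h
  have h2 := congrArg Prod.snd h
  simp only [latticeVec_fst, latticeVec_snd, Int.cast_inj] at h1 h2
  exact Prod.ext h1 h2

lemma latticeVec_eq_zero {u : ℤ × ℤ} : latticeVec u = 0 ↔ u = 0 := by
  rw [← latticeVec_zero, latticeVec_injective.eq_iff]

lemma det_add_right (a b c : Plane) : det a (b + c) = det a b + det a c := by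
  simp [det]; ring
lemma det_sub_right (a b c : Plane) : det a (b - c) = det a b - det a c := by
  simp [det]; ring
lemma det_smul_right (a b : Plane) (t : ℝ) : det a (t • b) = t * det a b := by
  simp [det]; ring
lemma det_neg_right (a b : Plane) : det a (-b) = -det a b := by
  simp [det]; ring
lemma det_add_left (a b c : Plane) : det (a + b) c = det a c + det b c := by
  simp [det]; ring

lemma det_smul_left (a b : Plane) (t : ℝ) : det (t • a) b = t * det a b := by
  simp [det]; ring
lemma det_neg_left (a b : Plane) : det (-a) b = -det a b := by
  simp [det]; ring
lemma det_swap (a b : Plane) : det a b = -det b a := by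
  simp [det]; ring
@[simp] lemma det_self (a : Plane) : det a a = 0 := by simp [det]; ring

lemma dot_rot (u : ℤ × ℤ) (y : Plane) : dot (latticeVec (rot u)) y = det (latticeVec u) y := by
  simp [dot, det]; ring

lemma dot_neg_left (a b : Plane) : dot (-a) b = -dot a b := by simp [dot]; ring
lemma dot_add_left (a b c : Plane) : dot (a + b) c = dot a c + dot b c := by simp [dot]; ring

lemma dot_sub_left (a b c : Plane) : dot (a - b) c = dot a c - dot b c := by simp [dot]; ring
lemma dot_smul_left (a b : Plane) (t : ℝ) : dot (t • a) b = t * dot a b := by simp [dot]; ring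
lemma dot_smul_right (a b : Plane) (t : ℝ) : dot a (t • b) = t * dot a b := by simp [dot]; ring

lemma dot_self_pos {a : Plane} (ha : a ≠ 0) : 0 < dot a a := by
  by_contra h
  apply ha
  simp only [dot, not_lt] at h
  ext
  · exact mul_self_eq_zero.1 (le_antisymm (by nlinarith [mul_self_nonneg a.2])
      (mul_self_nonneg a.1))
  · exact mul_self_eq_zero.1 (le_antisymm (by nlinarith [mul_self_nonneg a.1])
      (mul_self_nonneg a.2))

/-- Cramer's rule. -/
lemma add_smul_eq_add_smul_iff {ξ U : Plane} (h : det ξ U ≠ 0) (x P : Plane) (r t : ℝ) :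
    x + r • ξ = P + t • U ↔ t = det ξ (x - P) / det ξ U ∧ r = det U (x - P) / det ξ U := by
  rw [eq_div_iff h, eq_div_iff h]
  constructor
  · intro e
    have e' : x - P = t • U - r • ξ := by
      rw [sub_eq_sub_iff_add_eq_add, e, add_comm]
    constructor
    · rw [e', det_sub_right, det_smul_right, det_smul_right]; simp
    · rw [e', det_sub_right, det_smul_right, det_smul_right, det_swap U ξ]; simp
  · rintro ⟨h1, h2⟩
    have e1 : (x + r • ξ - (P + t • U)).1 * det ξ U = 0 := by
      simp only [det, Prod.fst_sub, Prod.snd_sub, Prod.fst_add, Prod.smul_fst, smul_eq_mul]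
        at h1 h2 ⊢
      linear_combination ξ.1 * h2 - U.1 * h1
    have e2 : (x + r • ξ - (P + t • U)).2 * det ξ U = 0 := by
      simp only [det, Prod.fst_sub, Prod.snd_sub, Prod.snd_add, Prod.smul_snd, smul_eq_mul]
        at h1 h2 ⊢
      linear_combination ξ.2 * h2 - U.2 * h1
    have e3 := (mul_eq_zero.1 e1).resolve_right h
    have e4 := (mul_eq_zero.1 e2).resolve_right h
    exact sub_eq_zero.1 (Prod.ext e3 e4)

lemma exists_smul_of_det_eq_zero {a b : Plane} (ha : a ≠ 0) (h : det a b = 0) :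
    ∃ t : ℝ, b = t • a := by
  refine ⟨dot a b / dot a a, ?_⟩
  have h0 := (dot_self_pos ha).ne'
  ext
  · simp only [Prod.smul_fst, smul_eq_mul]
    rw [div_mul_eq_mul_div, eq_div_iff h0]
    simp only [det, dot] at h ⊢
    linear_combination (-a.2) * h
  · simp only [Prod.smul_snd, smul_eq_mul]
    rw [div_mul_eq_mul_div, eq_div_iff h0]
    simp only [det, dot] at h ⊢
    linear_combination (a.1) * h

/-! ### Primitive vectors and generic directions -/

lemma _root_.IsPrimitiveVec.ne_zero {u : ℤ × ℤ} (h : IsPrimitiveVec u) : u ≠ 0 := by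
  rintro rfl
  simp only [IsPrimitiveVec, Prod.fst_zero, Prod.snd_zero] at h
  exact not_isCoprime_zero_zero h

lemma _root_.IsPrimitiveVec.latticeVec_ne_zero {u : ℤ × ℤ} (h : IsPrimitiveVec u) :
    latticeVec u ≠ 0 := fun e => h.ne_zero (latticeVec_eq_zero.1 e)

lemma _root_.IsPrimitiveVec.neg {u : ℤ × ℤ} (h : IsPrimitiveVec u) : IsPrimitiveVec (-u) := by
  exact IsCoprime.neg_neg h

lemma _root_.IsPrimitiveVec.rot {u : ℤ × ℤ} (h : IsPrimitiveVec u) : IsPrimitiveVec (rot u) := by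
  exact IsCoprime.neg_left (IsCoprime.symm h)

lemma _root_.IsPrimitiveVec.ne_neg {u : ℤ × ℤ} (h : IsPrimitiveVec u) : u ≠ -u := by
  intro e
  apply h.ne_zero
  have h1 := congrArg Prod.fst e
  have h2 := congrArg Prod.snd e
  simp only [Prod.fst_neg, Prod.snd_neg] at h1 h2
  exact Prod.ext (by simp; omega) (by simp; omega)

lemma _root_.IsPrimitiveVec.exists_eq_smul {u v : ℤ × ℤ} (hu : IsPrimitiveVec u)
    (h : det (latticeVec u) (latticeVec v) = 0) : ∃ k : ℤ, v = k • u := by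
  obtain ⟨a, b, hab⟩ := hu
  have h' : u.1 * v.2 = u.2 * v.1 := by
    simp only [det, latticeVec_fst, latticeVec_snd] at h
    have h2 : ((u.1 * v.2 : ℤ) : ℝ) = ((u.2 * v.1 : ℤ) : ℝ) := by
      push_cast; linarith
    exact_mod_cast h2
  refine ⟨a * v.1 + b * v.2, ?_⟩
  ext
  · simp only [Prod.smul_fst, smul_eq_mul]
    linear_combination (-v.1) * hab - b * h'
  · simp only [Prod.smul_snd, smul_eq_mul]
    linear_combination (-v.2) * hab + a * h'

lemma _root_.IsPrimitiveVec.eq_or_eq_neg {u v : ℤ × ℤ} (hu : IsPrimitiveVec u)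
    (hv : IsPrimitiveVec v) (h : det (latticeVec u) (latticeVec v) = 0) : v = u ∨ v = -u := by
  obtain ⟨k, hk⟩ := hu.exists_eq_smul h
  have hk1 : IsUnit k := by
    obtain ⟨a, b, hab⟩ := hv
    rw [hk] at hab
    simp only [Prod.smul_fst, Prod.smul_snd, smul_eq_mul] at hab
    exact IsUnit.of_mul_eq_one (a * u.1 + b * u.2) (by linear_combination hab)
  rcases Int.isUnit_iff.1 hk1 with rfl | rfl
  · left; simpa using hk
  · right; simpa using hk

lemma _root_.IsPrimitiveVec.eq_of_smul {u v : ℤ × ℤ} (hu : IsPrimitiveVec u)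
    (hv : IsPrimitiveVec v) {s t : ℝ} (hs : 0 < s) (ht : 0 < t)
    (h : s • latticeVec u = t • latticeVec v) : u = v := by
  have hd : det (latticeVec u) (latticeVec v) = 0 := by
    have : t * det (latticeVec u) (latticeVec v) = 0 := by
      rw [← det_smul_right, ← h, det_smul_right]; simp
    exact (mul_eq_zero.1 this).resolve_left ht.ne'
  rcases hu.eq_or_eq_neg hv hd with h1 | h1
  · exact h1.symm
  · exfalso
    rw [h1, latticeVec_neg, smul_neg, ← neg_smul] at h
    have h2 : (s + t) • latticeVec u = 0 := by rw [add_smul, h]; simp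
    rcases smul_eq_zero.1 h2 with h3 | h3
    · linarith
    · exact hu.latticeVec_ne_zero h3

/-- A vector of the plane is generic if it is not parallel to any nonzero integral vector. -/
def IsGeneric (ξ : Plane) : Prop := ∀ u : ℤ × ℤ, u ≠ 0 → det ξ (latticeVec u) ≠ 0

lemma IsGeneric.neg {ξ : Plane} (h : IsGeneric ξ) : IsGeneric (-ξ) := by
  intro u hu
  rw [det_neg_left]
  exact neg_ne_zero.2 (h u hu)

lemma IsGeneric.det_ne_zero {ξ : Plane} (h : IsGeneric ξ) {u : ℤ × ℤ} (hu : IsPrimitiveVec u) :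
    det ξ (latticeVec u) ≠ 0 := h u hu.ne_zero

lemma IsGeneric.det_ne_zero' {ξ : Plane} (h : IsGeneric ξ) {u : ℤ × ℤ} (hu : IsPrimitiveVec u) :
    det (latticeVec u) ξ ≠ 0 := by
  rw [det_swap]; exact neg_ne_zero.2 (h u hu.ne_zero)

/-- If `c ≠ d`, then `c - d` would be orthogonal to `ξ` and its rotation a nonzero lattice vector
parallel to `ξ`. This makes extremal lattice points in generic directions unique. -/
lemma IsGeneric.eq_of_dot_eq {ξ : Plane} (h : IsGeneric ξ) {c d : ℤ × ℤ}
    (e : dot (latticeVec c) ξ = dot (latticeVec d) ξ) : c = d := by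
  by_contra hne
  have h1 : rot (c - d) ≠ 0 := by
    intro h0
    exact hne (sub_eq_zero.1 (rot_injective (h0.trans (map_zero rot).symm)))
  apply h _ h1
  simp only [det, dot, latticeVec_fst, latticeVec_snd, rot_fst, rot_snd, Prod.fst_sub,
    Prod.snd_sub] at e ⊢
  push_cast
  linarith

lemma eq_zero_of_add_mul_sqrt_two {a b : ℤ} (h : (a : ℝ) + b * √2 = 0) : a = 0 ∧ b = 0 := by
  have hb : b = 0 := by
    by_contra hb
    have := (irrational_sqrt_two.intCast_mul hb).intCast_add a
    rw [h] at this
    exact this ⟨0, by simp⟩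
  subst hb
  simpa using h

lemma isGeneric_one_sqrt_two : IsGeneric (1, √2) := by
  intro u hu h
  apply hu
  have := eq_zero_of_add_mul_sqrt_two (a := u.2) (b := -u.1)
    (by simp only [det, latticeVec_fst, latticeVec_snd] at h; push_cast; linarith)
  exact Prod.ext (by simpa using this.2) this.1

lemma isGeneric_neg_one_sqrt_two : IsGeneric (-1, √2) := by
  intro u hu h
  apply hu
  have := eq_zero_of_add_mul_sqrt_two (a := -u.2) (b := -u.1)
    (by simp only [det, latticeVec_fst, latticeVec_snd] at h; push_cast; linarith)
  exact Prod.ext (by simpa using this.2) (by simpa using this.1)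

/-- Together with the two preceding vectors this one surrounds the origin, as `endWeight_balanced`
needs: the determinant of `(-1, √2)` and `(√2, -4)` is `4 - 2`. -/
lemma isGeneric_sqrt_two_neg_four : IsGeneric (√2, -4) := by
  intro u hu h
  apply hu
  have := eq_zero_of_add_mul_sqrt_two (a := 4 * u.1) (b := u.2)
    (by simp only [det, latticeVec_fst, latticeVec_snd] at h; push_cast; linarith)
  exact Prod.ext (by simpa using this.1) this.2

lemma countable_setOf_add_mul_eq_zero (a : ℝ) {b : ℝ} (hb : b ≠ 0) :
    {ε : ℝ | a + ε * b = 0}.Countable := by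
  refine (Set.countable_singleton (-a / b)).mono ?_
  intro ε hε
  simp only [Set.mem_ofPred_eq, Set.mem_singleton_iff] at hε ⊢
  rw [eq_div_iff hb]; linarith

/-- Each nonzero lattice vector excludes one `ε`: its determinant with `ξ + ε • η` is affine in `ε`,
with nonzero slope because `η` is generic. -/
lemma IsGeneric.countable_not_isGeneric {η : Plane} (hη : IsGeneric η) (ξ : Plane) :
    {ε : ℝ | ¬ IsGeneric (ξ + ε • η)}.Countable := by
  have : {ε : ℝ | ¬ IsGeneric (ξ + ε • η)} ⊆
      ⋃ u : {u : ℤ × ℤ // u ≠ 0}, {ε : ℝ | det ξ (latticeVec u) + ε * det η (latticeVec u) = 0} := by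
    intro ε hε
    simp only [IsGeneric, Set.mem_ofPred_eq, not_forall, not_not] at hε
    obtain ⟨u, hu, h⟩ := hε
    rw [det_add_left, det_smul_left] at h
    exact Set.mem_iUnion.2 ⟨⟨u, hu⟩, h⟩
  exact (Set.countable_iUnion fun u => countable_setOf_add_mul_eq_zero _ (hη _ u.2)).mono this

/-- Used to perturb a direction into a generic one without losing open conditions. -/
lemma exists_pos_of_eventually_of_countable {p : ℝ → Prop} (hp : ∀ᶠ ε in 𝓝[>] (0 : ℝ), p ε)
    {S : Set ℝ} (hS : S.Countable) : ∃ ε > 0, p ε ∧ ε ∉ S := by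
  obtain ⟨δ, hδ, h⟩ := mem_nhdsGT_iff_exists_Ioo_subset.1 hp
  obtain ⟨ε, hε, hε'⟩ := (hS.dense_compl ℝ).exists_mem_open isOpen_Ioo
    (Set.nonempty_Ioo.2 (Set.mem_Ioi.1 hδ))
  exact ⟨ε, hε'.1, h hε', hε⟩

end TropicalCurve

namespace TropicalCurve

/-! ### Parametrized edges -/

/-- The edge `E` is `P + t u`, where `u` is primitive and `t` runs over the segment, half-line or
line `I`. -/
structure IsEdgeParam (E : Set Plane) (P : Plane) (u : ℤ × ℤ) (I : Set ℝ) : Prop where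
  prim : IsPrimitiveVec u
  dom : (∃ l : ℝ, 0 < l ∧ I = Set.Icc 0 l) ∨ I = Set.Ici 0 ∨ I = Set.univ
  eq : E = (fun t : ℝ => P + t • latticeVec u) '' I

lemma _root_.IsRationalEdge.exists_param {E : Set Plane} (h : IsRationalEdge E) :
    ∃ P u I, IsEdgeParam E P u I := by
  obtain ⟨P, u, hu, ⟨l, hl, h⟩ | h | h⟩ := h
  · exact ⟨P, u, _, hu, Or.inl ⟨l, hl, rfl⟩, h⟩
  · exact ⟨P, u, _, hu, Or.inr (Or.inl rfl), h⟩
  · exact ⟨P, u, _, hu, Or.inr (Or.inr rfl), by rw [h, Set.image_univ]⟩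

namespace IsEdgeParam

variable {E : Set Plane} {P : Plane} {u : ℤ × ℤ} {I : Set ℝ}

lemma isRationalEdge (h : IsEdgeParam E P u I) : IsRationalEdge E := by
  obtain ⟨hu, ⟨l, hl, rfl⟩ | rfl | rfl, h⟩ := h
  · exact ⟨P, u, hu, Or.inl ⟨l, hl, h⟩⟩
  · exact ⟨P, u, hu, Or.inr (Or.inl h)⟩
  · exact ⟨P, u, hu, Or.inr (Or.inr (by rw [h, Set.image_univ]))⟩

lemma mem_iff (h : IsEdgeParam E P u I) {x : Plane} :
    x ∈ E ↔ ∃ t ∈ I, P + t • latticeVec u = x := by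
  rw [h.eq]; rfl

lemma mem {t : ℝ} (h : IsEdgeParam E P u I) (ht : t ∈ I) : P + t • latticeVec u ∈ E :=
  h.mem_iff.2 ⟨t, ht, rfl⟩

lemma param_injective (h : IsEdgeParam E P u I) {s t : ℝ}
    (e : P + s • latticeVec u = P + t • latticeVec u) : s = t :=
  smul_left_injective ℝ h.prim.latticeVec_ne_zero (add_left_cancel e)

lemma param_mem_iff (h : IsEdgeParam E P u I) {t : ℝ} : P + t • latticeVec u ∈ E ↔ t ∈ I := by
  rw [h.mem_iff]
  constructor
  · rintro ⟨s, hs, e⟩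
    rwa [← h.param_injective e]
  · intro ht
    exact ⟨t, ht, rfl⟩

lemma zero_mem_dom (h : IsEdgeParam E P u I) : (0 : ℝ) ∈ I := by
  obtain ⟨_, ⟨l, hl, rfl⟩ | rfl | rfl, _⟩ := h
  · exact ⟨le_rfl, hl.le⟩
  · exact Set.self_mem_Ici
  · trivial

lemma base_mem (h : IsEdgeParam E P u I) : P ∈ E :=
  h.mem_iff.2 ⟨0, h.zero_mem_dom, by simp⟩

lemma exists_pos_mem_dom (h : IsEdgeParam E P u I) : ∃ t ∈ I, 0 < t := by
  obtain ⟨_, ⟨l, hl, rfl⟩ | rfl | rfl, _⟩ := h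
  · exact ⟨l, ⟨hl.le, le_rfl⟩, hl⟩
  · exact ⟨1, by simp, one_pos⟩
  · exact ⟨1, trivial, one_pos⟩

lemma isClosed_dom (h : IsEdgeParam E P u I) : IsClosed I := by
  obtain ⟨_, ⟨l, hl, rfl⟩ | rfl | rfl, _⟩ := h
  · exact isClosed_Icc
  · exact isClosed_Ici
  · exact isClosed_univ

lemma interior_dom_nonempty (h : IsEdgeParam E P u I) : (interior I).Nonempty := by
  obtain ⟨_, ⟨l, hl, rfl⟩ | rfl | rfl, _⟩ := h
  · rw [interior_Icc]; exact Set.nonempty_Ioo.2 hl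
  · rw [interior_Ici]; exact ⟨1, Set.mem_Ioi.2 one_pos⟩
  · rw [interior_univ]; exact ⟨1, trivial⟩

lemma finite_dom_diff_interior (h : IsEdgeParam E P u I) : (I \ interior I).Finite := by
  obtain ⟨_, ⟨l, hl, rfl⟩ | rfl | rfl, _⟩ := h
  · rw [interior_Icc, Set.Icc_sdiff_Ioo_same hl.le]; exact Set.toFinite _
  · rw [interior_Ici, Set.Ici_sdiff_Ioi_same]; exact Set.toFinite _
  · simp

lemma det_sub (h : IsEdgeParam E P u I) {x y : Plane} (hx : x ∈ E) (hy : y ∈ E) :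
    det (latticeVec u) (x - y) = 0 := by
  obtain ⟨s, -, rfl⟩ := h.mem_iff.1 hx
  obtain ⟨t, -, rfl⟩ := h.mem_iff.1 hy
  rw [add_sub_add_left_eq_sub, ← sub_smul, det_smul_right]; simp

/-- The second condition reads off the parameter by orthogonal projection. Both conditions are
closed in `x`, which gives `isClosed`. -/
lemma mem_iff_det (h : IsEdgeParam E P u I) {x : Plane} :
    x ∈ E ↔ det (latticeVec u) (x - P) = 0 ∧
      dot (latticeVec u) (x - P) / dot (latticeVec u) (latticeVec u) ∈ I := by
  have h0 := (dot_self_pos h.prim.latticeVec_ne_zero).ne'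
  constructor
  · intro hx
    refine ⟨h.det_sub hx h.base_mem, ?_⟩
    obtain ⟨t, ht, rfl⟩ := h.mem_iff.1 hx
    rwa [add_sub_cancel_left, dot_smul_right, mul_div_cancel_right₀ _ h0]
  · rintro ⟨h1, h2⟩
    obtain ⟨t, ht⟩ := exists_smul_of_det_eq_zero h.prim.latticeVec_ne_zero h1
    rw [ht, dot_smul_right, mul_div_cancel_right₀ _ h0] at h2
    exact h.mem_iff.2 ⟨t, h2, by rw [← ht]; abel⟩

lemma isClosed (h : IsEdgeParam E P u I) : IsClosed E := by
  have : E = {x | det (latticeVec u) (x - P) = 0} ∩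
      (fun x => dot (latticeVec u) (x - P) / dot (latticeVec u) (latticeVec u)) ⁻¹' I := by
    ext x; exact h.mem_iff_det
  rw [this]
  refine IsClosed.inter (isClosed_eq ?_ continuous_const) (h.isClosed_dom.preimage ?_)
  · unfold det; fun_prop
  · unfold dot; fun_prop

lemma mem_extremePoints_iff (h : IsEdgeParam E P u I) {t : ℝ} :
    P + t • latticeVec u ∈ E.extremePoints ℝ ↔ t ∈ I \ interior I := by
  constructor
  · rintro ⟨hE, hext⟩
    refine ⟨h.param_mem_iff.1 hE, fun hint => ?_⟩
    obtain ⟨δ, hδ, hb⟩ := Metric.isOpen_iff.1 isOpen_interior t hint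
    have h1 : t - δ / 2 ∈ I := interior_subset (hb (by
      rw [Metric.mem_ball, Real.dist_eq, abs_lt]; constructor <;> linarith))
    have h2 : t + δ / 2 ∈ I := interior_subset (hb (by
      rw [Metric.mem_ball, Real.dist_eq, abs_lt]; constructor <;> linarith))
    have := hext (h.mem h1) (h.mem h2) ⟨1/2, 1/2, by norm_num, by norm_num, by norm_num, by
      ext <;> simp <;> ring⟩
    have := h.param_injective this
    linarith
  · intro ht
    refine ⟨h.mem ht.1, ?_⟩
    intro x hx y hy hxy
    obtain ⟨a, ha, rfl⟩ := h.mem_iff.1 hx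
    obtain ⟨b, hb, rfl⟩ := h.mem_iff.1 hy
    obtain ⟨α, β, hα, hβ, hαβ, e⟩ := hxy
    have e' : P + (α * a + β * b) • latticeVec u = P + t • latticeVec u := by
      rw [← e]
      have hβ' : β = 1 - α := by linarith
      subst hβ'
      ext <;> simp <;> ring
    have e'' := h.param_injective e'
    suffices a = t by rw [this]
    -- The parameter `t` is an extreme value on `I`, and a positive combination of nonnegative
    -- numbers vanishes only if each of them does.
    obtain ⟨_, ⟨l, hl, rfl⟩ | rfl | rfl, _⟩ := h
    · rw [interior_Icc, Set.Icc_sdiff_Ioo_same hl.le] at ht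
      rcases ht with rfl | rfl
      · have h1 := mul_nonneg hα.le ha.1
        have h2 := mul_nonneg hβ.le hb.1
        have h3 : α * a = 0 := by linarith
        exact (mul_eq_zero.1 h3).resolve_left hα.ne'
      · have h1 := mul_nonneg hα.le (sub_nonneg.2 ha.2)
        have h2 := mul_nonneg hβ.le (sub_nonneg.2 hb.2)
        have h3 : α * (t - a) = 0 := by
          apply le_antisymm _ h1
          have : β = 1 - α := by linarith
          subst this
          linarith
        have := (mul_eq_zero.1 h3).resolve_left hα.ne'
        linarith
    · rw [interior_Ici, Set.Ici_sdiff_Ioi_same] at ht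
      rw [Set.mem_singleton_iff.1 ht] at e'' ⊢
      have h1 := mul_nonneg hα.le ha
      have h2 := mul_nonneg hβ.le hb
      have h3 : α * a = 0 := by linarith
      exact (mul_eq_zero.1 h3).resolve_left hα.ne'
    · simp at ht

lemma finite_extremePoints (h : IsEdgeParam E P u I) : (E.extremePoints ℝ).Finite := by
  refine (h.finite_dom_diff_interior.image fun t => P + t • latticeVec u).subset ?_
  intro x hx
  obtain ⟨t, -, rfl⟩ := h.mem_iff.1 hx.1
  exact ⟨t, h.mem_extremePoints_iff.1 hx, rfl⟩

/-- A segment may be parametrized from its other end. -/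
lemma reverse {l : ℝ} (h : IsEdgeParam E P u (Set.Icc 0 l)) :
    IsEdgeParam E (P + l • latticeVec u) (-u) (Set.Icc 0 l) := by
  refine ⟨h.prim.neg, ?_, ?_⟩
  · obtain ⟨t, ht, ht'⟩ := h.exists_pos_mem_dom
    exact Or.inl ⟨l, ht'.trans_le ht.2, rfl⟩
  · ext x
    rw [h.mem_iff]
    constructor
    · rintro ⟨t, ht, rfl⟩
      refine ⟨l - t, ⟨by linarith [ht.2], by linarith [ht.1]⟩, ?_⟩
      ext <;> simp <;> ring
    · rintro ⟨t, ht, rfl⟩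
      refine ⟨l - t, ⟨by linarith [ht.2], by linarith [ht.1]⟩, ?_⟩
      ext <;> simp <;> ring

/-- A line may be parametrized in the opposite direction. -/
lemma reverse_line (h : IsEdgeParam E P u Set.univ) : IsEdgeParam E P (-u) Set.univ := by
  refine ⟨h.prim.neg, Or.inr (Or.inr rfl), ?_⟩
  ext x
  rw [h.mem_iff]
  constructor
  · rintro ⟨t, -, rfl⟩
    exact ⟨-t, trivial, by simp⟩
  · rintro ⟨t, -, rfl⟩
    exact ⟨-t, trivial, by simp⟩

lemma eq_or_eq_neg {P' : Plane} {u' : ℤ × ℤ} {I' : Set ℝ} (h : IsEdgeParam E P u I)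
    (h' : IsEdgeParam E P' u' I') : u' = u ∨ u' = -u := by
  apply h.prim.eq_or_eq_neg h'.prim
  obtain ⟨t, ht, ht0⟩ := h'.exists_pos_mem_dom
  have := h.det_sub (h'.mem ht) h'.base_mem
  rw [add_sub_cancel_left, det_smul_right] at this
  exact (mul_eq_zero.1 this).resolve_left ht0.ne'

/-- At an endpoint, the edge is parametrized by its primitive vector. -/
lemma of_extremePoint {V : Plane} {v : ℤ × ℤ} (h : IsEdgeParam E P u I)
    (hV : V ∈ E.extremePoints ℝ) (hv : IsPrimitiveVecAt V E v) :
    ∃ J, IsEdgeParam E V v J ∧ ((∃ l : ℝ, 0 < l ∧ J = Set.Icc 0 l) ∨ J = Set.Ici 0) := by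
  obtain ⟨hv, s, hs, hmem⟩ := hv
  obtain ⟨t, -, rfl⟩ := h.mem_iff.1 hV.1
  have ht := h.mem_extremePoints_iff.1 hV
  -- In a parametrization whose domain starts at `0`, the point in the direction `v` has a
  -- nonnegative parameter; this rules out the opposite primitive vector.
  have base : ∀ {P u J}, IsEdgeParam E P u J → P + s • latticeVec v ∈ E →
      ((∃ l : ℝ, 0 < l ∧ J = Set.Icc 0 l) ∨ J = Set.Ici 0) → v = u := by
    intro P u J h hmem hJ
    obtain ⟨r, hr, e⟩ := h.mem_iff.1 hmem
    have e := add_left_cancel e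
    have hr0 : 0 ≤ r := by
      rcases hJ with ⟨l, hl, rfl⟩ | rfl
      · exact hr.1
      · exact hr
    rcases hr0.eq_or_lt with h0 | h0
    · rw [← h0, zero_smul] at e
      rcases smul_eq_zero.1 e.symm with h1 | h1
      · exact absurd h1 hs.ne'
      · exact absurd h1 hv.latticeVec_ne_zero
    · exact (h.prim.eq_of_smul hv h0 hs e).symm
  rcases h.dom with ⟨l, hl, rfl⟩ | rfl | rfl
  · rw [interior_Icc, Set.Icc_sdiff_Ioo_same hl.le] at ht
    rcases ht with rfl | rfl
    · simp only [zero_smul, add_zero] at hmem ⊢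
      rw [base h hmem (Or.inl ⟨l, hl, rfl⟩)]
      exact ⟨_, h, Or.inl ⟨l, hl, rfl⟩⟩
    · have h' := h.reverse
      rw [base h' hmem (Or.inl ⟨t, hl, rfl⟩)]
      exact ⟨_, h', Or.inl ⟨t, hl, rfl⟩⟩
  · rw [interior_Ici, Set.Ici_sdiff_Ioi_same] at ht
    obtain rfl := Set.mem_singleton_iff.1 ht
    simp only [zero_smul, add_zero] at hmem ⊢
    rw [base h hmem (Or.inr rfl)]
    exact ⟨_, h, Or.inr rfl⟩
  · simp at ht

end IsEdgeParam

/-! ### Ends of sets -/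

/-- The primitive directions of the rays contained in a set. -/
def endSet (E : Set Plane) : Set (ℤ × ℤ) :=
  {u | IsPrimitiveVec u ∧ ∃ P : Plane, ∀ t : ℝ, 0 ≤ t → P + t • latticeVec u ∈ E}

lemma eventually_notMem_of_isBounded {E : Set Plane} (h : Bornology.IsBounded E) {u : ℤ × ℤ}
    (hu : IsPrimitiveVec u) (P : Plane) : ∀ᶠ t : ℝ in atTop, P + t • latticeVec u ∉ E := by
  obtain ⟨C, hC⟩ := h.exists_norm_le
  have hpos := norm_pos_iff.2 hu.latticeVec_ne_zero
  filter_upwards [eventually_gt_atTop ((C + ‖P‖) / ‖latticeVec u‖), eventually_ge_atTop 0]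
    with t ht ht0 hmem
  have h1 := hC _ hmem
  rw [div_lt_iff₀ hpos] at ht
  have h3 : ‖t • latticeVec u‖ ≤ ‖P + t • latticeVec u‖ + ‖P‖ := by
    have := norm_sub_le (P + t • latticeVec u) P
    rwa [add_sub_cancel_left] at this
  rw [norm_smul, Real.norm_of_nonneg ht0] at h3
  linarith

lemma endSet_eq_empty_of_isBounded {E : Set Plane} (h : Bornology.IsBounded E) :
    endSet E = ∅ := by
  rw [Set.eq_empty_iff_forall_notMem]
  rintro u ⟨hu, P, hP⟩
  obtain ⟨t, h1, h2⟩ :=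
    ((eventually_notMem_of_isBounded h hu P).and (eventually_ge_atTop 0)).exists
  exact h1 (hP t h2)

lemma IsEdgeParam.isBounded {E : Set Plane} {P : Plane} {u : ℤ × ℤ} {l : ℝ}
    (h : IsEdgeParam E P u (Set.Icc 0 l)) : Bornology.IsBounded E := by
  rw [h.eq]
  exact (isCompact_Icc.image (by fun_prop)).isBounded

lemma IsEdgeParam.endSet_segment {E : Set Plane} {P : Plane} {u : ℤ × ℤ} {l : ℝ}
    (h : IsEdgeParam E P u (Set.Icc 0 l)) : endSet E = ∅ :=
  endSet_eq_empty_of_isBounded h.isBounded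

lemma IsEdgeParam.eq_or_eq_neg_of_mem_endSet {E : Set Plane} {P : Plane} {u : ℤ × ℤ} {I : Set ℝ}
    (h : IsEdgeParam E P u I) {v : ℤ × ℤ} (hv : v ∈ endSet E) : v = u ∨ v = -u := by
  obtain ⟨hv, Q, hQ⟩ := hv
  apply h.prim.eq_or_eq_neg hv
  have := h.det_sub (hQ 1 zero_le_one) (hQ 0 le_rfl)
  simpa using this

lemma IsEdgeParam.endSet_ray {E : Set Plane} {P : Plane} {u : ℤ × ℤ}
    (h : IsEdgeParam E P u (Set.Ici 0)) : endSet E = {u} := by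
  ext v
  rw [Set.mem_singleton_iff]
  constructor
  · intro hv
    rcases h.eq_or_eq_neg_of_mem_endSet hv with h1 | rfl
    · exact h1
    · exfalso
      obtain ⟨-, Q, hQ⟩ := hv
      have h0 := hQ 0 le_rfl
      rw [zero_smul, add_zero] at h0
      obtain ⟨a, ha, rfl⟩ := h.mem_iff.1 h0
      have ha : 0 ≤ a := ha
      have h1 := hQ (a + 1) (by linarith)
      have e : P + a • latticeVec u + (a + 1) • latticeVec (-u) = P + (-1 : ℝ) • latticeVec u := by
        ext <;> simp <;> ring
      rw [e, h.param_mem_iff] at h1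
      have : (0 : ℝ) ≤ -1 := h1
      linarith
  · rintro rfl
    exact ⟨h.prim, P, fun t ht => h.mem ht⟩

lemma IsEdgeParam.endSet_line {E : Set Plane} {P : Plane} {u : ℤ × ℤ}
    (h : IsEdgeParam E P u Set.univ) : endSet E = {u, -u} := by
  ext v
  constructor
  · exact h.eq_or_eq_neg_of_mem_endSet
  · rintro (rfl | rfl)
    · exact ⟨h.prim, P, fun t _ => h.mem trivial⟩
    · exact ⟨h.prim.neg, P, fun t _ => h.reverse_line.mem trivial⟩

lemma endSet_finite {E : Set Plane} (h : IsRationalEdge E) : (endSet E).Finite := by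
  obtain ⟨P, u, I, h⟩ := h.exists_param
  exact (Set.toFinite {u, -u}).subset fun v hv => h.eq_or_eq_neg_of_mem_endSet hv

lemma endSet_subset_image_add (E : Set Plane) (c : Plane) :
    endSet E ⊆ endSet ((fun x => x + c) '' E) := by
  rintro u ⟨hu, P, hP⟩
  exact ⟨hu, P + c, fun t ht => ⟨_, hP t ht, by dsimp only; abel⟩⟩

lemma endSet_image_add (E : Set Plane) (c : Plane) :
    endSet ((fun x => x + c) '' E) = endSet E := by
  refine subset_antisymm ?_ (endSet_subset_image_add E c)
  have := endSet_subset_image_add ((fun x => x + c) '' E) (-c)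
  rw [Set.image_image] at this
  simpa using this

open scoped Classical in
/-- The finite set of primitive directions of the rays contained in an edge. -/
noncomputable def ends (E : Set Plane) : Finset (ℤ × ℤ) :=
  if h : (endSet E).Finite then h.toFinset else ∅

lemma mem_ends_iff {E : Set Plane} (h : (endSet E).Finite) {u : ℤ × ℤ} :
    u ∈ ends E ↔ u ∈ endSet E := by
  rw [ends, dif_pos h, Set.Finite.mem_toFinset]

lemma mem_ends {E : Set Plane} (h : IsRationalEdge E) {u : ℤ × ℤ} : u ∈ ends E ↔ u ∈ endSet E :=
  mem_ends_iff (endSet_finite h)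

lemma isPrimitiveVec_of_mem_ends {E : Set Plane} {u : ℤ × ℤ} (h : u ∈ ends E) :
    IsPrimitiveVec u := by
  unfold ends at h
  split_ifs at h with hf
  · exact ((Set.Finite.mem_toFinset hf).1 h).1
  · simp at h

lemma IsEdgeParam.ends_segment {E : Set Plane} {P : Plane} {u : ℤ × ℤ} {l : ℝ}
    (h : IsEdgeParam E P u (Set.Icc 0 l)) : ends E = ∅ := by
  ext v; rw [mem_ends h.isRationalEdge, h.endSet_segment]; simp

lemma IsEdgeParam.ends_ray {E : Set Plane} {P : Plane} {u : ℤ × ℤ}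
    (h : IsEdgeParam E P u (Set.Ici 0)) : ends E = {u} := by
  ext v; rw [mem_ends h.isRationalEdge, h.endSet_ray]; simp

lemma IsEdgeParam.ends_line {E : Set Plane} {P : Plane} {u : ℤ × ℤ}
    (h : IsEdgeParam E P u Set.univ) : ends E = {u, -u} := by
  ext v; rw [mem_ends h.isRationalEdge, h.endSet_line]; simp

end TropicalCurve

namespace TropicalCurve

/-! ### Sums over the edges which lie beyond a point in a given direction -/

/-- The points `x` such that the ray from `x` in the direction `ξ` crosses `E`; the endpoint of `E`
which is the last one in the direction transversal to `ξ` is disregarded. -/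
def shadow (ξ : Plane) (E : Set Plane) : Set Plane :=
  {x | (∃ r : ℝ, 0 < r ∧ x + r • ξ ∈ E) ∧ ∃ y ∈ E, det ξ x < det ξ y}

open scoped Classical in
/-- The normal vector of an edge of direction `u` which points to the side of `ξ`. -/
noncomputable def normalToward (ξ : Plane) (u : ℤ × ℤ) : ℤ × ℤ :=
  if 0 < det (latticeVec u) ξ then rot u else -rot u

lemma normalToward_neg {ξ : Plane} {u : ℤ × ℤ} (h : det (latticeVec u) ξ ≠ 0) :
    normalToward ξ (-u) = normalToward ξ u := by
  unfold normalToward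
  rw [latticeVec_neg, det_neg_left, map_neg, neg_neg]
  rcases h.lt_or_gt with h | h
  · rw [if_pos (by linarith), if_neg (by linarith)]
  · rw [if_neg (by linarith), if_pos (by linarith)]

lemma dot_normalToward_pos {ξ : Plane} {u : ℤ × ℤ} (h : det (latticeVec u) ξ ≠ 0) :
    0 < dot (latticeVec (normalToward ξ u)) ξ := by
  unfold normalToward
  rcases h.lt_or_gt with h | h
  · rw [if_neg (by linarith), latticeVec_neg, dot_neg_left, dot_rot]; linarith
  · rw [if_pos (by linarith), dot_rot]; linarith

open scoped Classical in
/-- A primitive vector in the direction of an edge. -/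
noncomputable def direction (E : Set Plane) : ℤ × ℤ :=
  if h : IsRationalEdge E then h.exists_param.choose_spec.choose else 0

lemma exists_param_direction {E : Set Plane} (h : IsRationalEdge E) :
    ∃ P I, IsEdgeParam E P (direction E) I := by
  rw [direction, dif_pos h]
  obtain ⟨I, hI⟩ := h.exists_param.choose_spec.choose_spec
  exact ⟨_, I, hI⟩

open scoped Classical in
/-- The contribution of an edge of weight one to `potential`. -/
noncomputable def shadowTerm (ξ : Plane) (E : Set Plane) (x : Plane) : ℤ × ℤ :=
  if x ∈ shadow ξ E then -normalToward ξ (direction E) else 0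

namespace IsEdgeParam

variable {E : Set Plane} {P : Plane} {u : ℤ × ℤ} {I : Set ℝ} {ξ : Plane}

lemma normalToward_direction (h : IsEdgeParam E P u I) (hξ : IsGeneric ξ) :
    normalToward ξ (direction E) = normalToward ξ u := by
  obtain ⟨Q, J, hJ⟩ := exists_param_direction h.isRationalEdge
  rcases h.eq_or_eq_neg hJ with e | e
  · rw [e]
  · rw [e, normalToward_neg (hξ.det_ne_zero' h.prim)]

/-- A line of generic direction is transversal to every edge, so Cramer's rule gives both the
parameter of the crossing on the edge and its position `r` on the ray. -/
lemma add_smul_mem_iff (h : IsEdgeParam E P u I) (hξ : IsGeneric ξ) {x : Plane} {r : ℝ} :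
    x + r • ξ ∈ E ↔ det ξ (x - P) / det ξ (latticeVec u) ∈ I ∧
      r = det (latticeVec u) (x - P) / det ξ (latticeVec u) := by
  rw [h.mem_iff]
  constructor
  · rintro ⟨t, ht, e⟩
    obtain ⟨h1, h2⟩ := (add_smul_eq_add_smul_iff (hξ.det_ne_zero h.prim) _ _ _ _).1 e.symm
    exact ⟨h1 ▸ ht, h2⟩
  · rintro ⟨h1, h2⟩
    exact ⟨_, h1, ((add_smul_eq_add_smul_iff (hξ.det_ne_zero h.prim) _ _ _ _).2 ⟨rfl, h2⟩).symm⟩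

lemma mem_iff_generic (h : IsEdgeParam E P u I) (hξ : IsGeneric ξ) {x : Plane} :
    x ∈ E ↔ det ξ (x - P) / det ξ (latticeVec u) ∈ I ∧
      det (latticeVec u) (x - P) / det ξ (latticeVec u) = 0 := by
  have := h.add_smul_mem_iff hξ (x := x) (r := 0)
  rw [zero_smul, add_zero] at this
  rw [this, eq_comm (a := (0 : ℝ))]

lemma mem_shadow_iff (h : IsEdgeParam E P u I) (hξ : IsGeneric ξ) {x : Plane} :
    x ∈ shadow ξ E ↔ det ξ (x - P) / det ξ (latticeVec u) ∈ I ∧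
      0 < det (latticeVec u) (x - P) / det ξ (latticeVec u) ∧
      ∃ t ∈ I, det ξ (x - P) < t * det ξ (latticeVec u) := by
  have h1 : (∃ r : ℝ, 0 < r ∧ x + r • ξ ∈ E) ↔ det ξ (x - P) / det ξ (latticeVec u) ∈ I ∧
      0 < det (latticeVec u) (x - P) / det ξ (latticeVec u) := by
    constructor
    · rintro ⟨r, hr, hx⟩
      obtain ⟨h1, h2⟩ := (h.add_smul_mem_iff hξ).1 hx
      exact ⟨h1, h2 ▸ hr⟩
    · rintro ⟨h1, h2⟩
      exact ⟨_, h2, (h.add_smul_mem_iff hξ).2 ⟨h1, rfl⟩⟩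
  have h2 : (∃ y ∈ E, det ξ x < det ξ y) ↔ ∃ t ∈ I, det ξ (x - P) < t * det ξ (latticeVec u) := by
    constructor
    · rintro ⟨y, hy, hxy⟩
      obtain ⟨t, ht, rfl⟩ := h.mem_iff.1 hy
      refine ⟨t, ht, ?_⟩
      rw [det_add_right, det_smul_right] at hxy
      rw [det_sub_right]; linarith
    · rintro ⟨t, ht, hx⟩
      refine ⟨_, h.mem ht, ?_⟩
      rw [det_sub_right] at hx
      rw [det_add_right, det_smul_right]; linarith
  rw [shadow, Set.mem_ofPred_eq, h1, h2, and_assoc]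

lemma continuous_coord (P : Plane) (c : ℝ) (a : Plane) :
    Continuous fun x : Plane => det a (x - P) / c := by
  unfold det; fun_prop

/-- At an interior parameter the edge continues to both sides of the line in the direction `ξ`, so
the second clause of `shadow` is automatic there. -/
lemma exists_mem_lt_of_mem_interior (h : IsEdgeParam E P u I) (hξ : IsGeneric ξ) {s : ℝ}
    (hs : s / det ξ (latticeVec u) ∈ interior I) : ∃ t ∈ I, s < t * det ξ (latticeVec u) := by
  have hd := hξ.det_ne_zero h.prim
  obtain ⟨δ, hδ, hb⟩ := Metric.isOpen_iff.1 isOpen_interior _ hs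
  rcases hd.lt_or_gt with hd' | hd'
  · refine ⟨s / det ξ (latticeVec u) - δ / 2, interior_subset (hb ?_), ?_⟩
    · rw [Metric.mem_ball, Real.dist_eq, abs_lt]; constructor <;> linarith
    · rw [sub_mul, div_mul_cancel₀ _ hd]; nlinarith
  · refine ⟨s / det ξ (latticeVec u) + δ / 2, interior_subset (hb ?_), ?_⟩
    · rw [Metric.mem_ball, Real.dist_eq, abs_lt]; constructor <;> linarith
    · rw [add_mul, div_mul_cancel₀ _ hd]; nlinarith

lemma eventually_mem_shadow (h : IsEdgeParam E P u I) (hξ : IsGeneric ξ) {x : Plane}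
    (h1 : det ξ (x - P) / det ξ (latticeVec u) ∈ interior I)
    (h2 : 0 < det (latticeVec u) (x - P) / det ξ (latticeVec u)) :
    ∀ᶠ y in 𝓝 x, y ∈ shadow ξ E := by
  have c1 := (continuous_coord P (det ξ (latticeVec u)) ξ).continuousAt.eventually
    (isOpen_interior.mem_nhds h1)
  have c2 := (continuous_coord P (det ξ (latticeVec u)) (latticeVec u)).continuousAt.eventually
    (isOpen_Ioi.mem_nhds h2)
  filter_upwards [c1, c2] with y hy1 hy2
  exact (h.mem_shadow_iff hξ).2 ⟨interior_subset hy1, hy2, h.exists_mem_lt_of_mem_interior hξ hy1⟩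

/-- When the closed ray from `x` misses `E`, either the crossing parameter lies outside the closed
domain or the crossing lies strictly behind `x`. Both conditions are open. -/
lemma eventually_notMem_shadow (h : IsEdgeParam E P u I) (hξ : IsGeneric ξ) {x : Plane}
    (hx : x ∉ E) (hx' : ∀ r > (0 : ℝ), x + r • ξ ∉ E) : ∀ᶠ y in 𝓝 x, y ∉ shadow ξ E := by
  by_cases h1 : det ξ (x - P) / det ξ (latticeVec u) ∈ I
  · have h2 : det (latticeVec u) (x - P) / det ξ (latticeVec u) < 0 := by
      by_contra hcon
      rcases (not_lt.1 hcon).eq_or_lt with h0 | h0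
      · exact hx ((h.mem_iff_generic hξ).2 ⟨h1, h0.symm⟩)
      · exact hx' (det (latticeVec u) (x - P) / det ξ (latticeVec u)) h0
          ((h.add_smul_mem_iff hξ).2 ⟨h1, rfl⟩)
    have c2 := (continuous_coord P (det ξ (latticeVec u)) (latticeVec u)).continuousAt.eventually
      (isOpen_Iio.mem_nhds h2)
    filter_upwards [c2] with y hy hy'
    exact lt_asymm hy ((h.mem_shadow_iff hξ).1 hy').2.1
  · have c1 := (continuous_coord P (det ξ (latticeVec u)) ξ).continuousAt.eventually
      (h.isClosed_dom.isOpen_compl.mem_nhds h1)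
    filter_upwards [c1] with y hy hy'
    exact hy ((h.mem_shadow_iff hξ).1 hy').1

/-- This is where the half-open convention in `shadow` acts: if the ray from `x` hits the starting
point of `E`, the edge is seen from one side only, and the boundary case `det ξ y = det ξ x` is
counted for edges on the positive side alone. -/
lemma eventually_mem_shadow_iff_of_endpoint (h : IsEdgeParam E P u I) (hξ : IsGeneric ξ)
    (hI : (∃ l : ℝ, 0 < l ∧ I = Set.Icc 0 l) ∨ I = Set.Ici 0) {x : Plane} {r : ℝ} (hr : 0 < r)
    (hx : x + r • ξ = P) :
    ∀ᶠ y in 𝓝 x, (y ∈ shadow ξ E ↔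
      (0 < det ξ (latticeVec u) ∧ det ξ x ≤ det ξ y) ∨
        (det ξ (latticeVec u) < 0 ∧ det ξ y < det ξ x)) := by
  have hd := hξ.det_ne_zero h.prim
  have hP : det ξ P = det ξ x := by rw [← hx, det_add_right, det_smul_right]; simp
  have hr' : det (latticeVec u) (x - P) / det ξ (latticeVec u) = r := by
    have : x - P = -(r • ξ) := by rw [← hx]; abel
    rw [this, det_neg_right, det_smul_right, det_swap (latticeVec u) ξ, div_eq_iff hd]; ring
  have c2 := (continuous_coord P (det ξ (latticeVec u)) (latticeVec u)).continuousAt.eventually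
    (isOpen_Ioi.mem_nhds (show _ ∈ Set.Ioi (0 : ℝ) from hr' ▸ hr))
  obtain ⟨l, hl, hlI⟩ : ∃ l > 0, Set.Icc 0 l ⊆ I := by
    rcases hI with ⟨l, hl, rfl⟩ | rfl
    · exact ⟨l, hl, subset_rfl⟩
    · exact ⟨1, one_pos, Set.Icc_subset_Ici_self⟩
  have hI0 : ∀ t ∈ I, 0 ≤ t := by
    rcases hI with ⟨l, hl, rfl⟩ | rfl
    · exact fun t ht => ht.1
    · exact fun t ht => ht
  have hx0 : det ξ (x - P) / det ξ (latticeVec u) = 0 := by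
    rw [det_sub_right, hP]; simp
  have c1 := (continuous_coord P (det ξ (latticeVec u)) ξ).continuousAt.eventually
    (isOpen_Iio.mem_nhds (show _ ∈ Set.Iio l from hx0 ▸ hl))
  filter_upwards [c1, c2] with y hy1 hy2
  have hy1 : det ξ (y - P) / det ξ (latticeVec u) < l := hy1
  rw [h.mem_shadow_iff hξ]
  have hyP : det ξ (y - P) = det ξ y - det ξ x := by rw [det_sub_right, hP]
  rw [hyP] at hy1 ⊢
  rcases hd.lt_or_gt with hd' | hd'
  · constructor
    · rintro ⟨-, -, t, ht, htlt⟩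
      have := mul_nonpos_of_nonneg_of_nonpos (hI0 t ht) hd'.le
      exact Or.inr ⟨hd', by linarith⟩
    · rintro (⟨h3, -⟩ | ⟨-, h3⟩)
      · linarith
      · exact ⟨hlI ⟨(div_pos_of_neg_of_neg (by linarith) hd').le, hy1.le⟩, hy2, 0, h.zero_mem_dom,
          by linarith⟩
  · constructor
    · rintro ⟨h3, -, -⟩
      have := hI0 _ h3
      rw [le_div_iff₀ hd'] at this
      exact Or.inl ⟨hd', by linarith⟩
    · rintro (⟨-, h3⟩ | ⟨h3, -⟩)
      · exact ⟨hlI ⟨div_nonneg (by linarith) hd'.le, hy1.le⟩, hy2, l, hlI ⟨hl.le, le_rfl⟩,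
          by rwa [div_lt_iff₀ hd'] at hy1⟩
      · linarith

-- An edge on the positive side loses the term `rot u`, one on the negative side gains `-rot u`. The
-- change is `-rot u` either way, so the changes at a vertex add up to a rotated balancing sum.
open scoped Classical in
lemma eventually_shadowTerm_of_endpoint (h : IsEdgeParam E P u I) (hξ : IsGeneric ξ)
    (hI : (∃ l : ℝ, 0 < l ∧ I = Set.Icc 0 l) ∨ I = Set.Ici 0) {x : Plane} {r : ℝ} (hr : 0 < r)
    (hx : x + r • ξ = P) :
    ∀ᶠ y in 𝓝 x, shadowTerm ξ E y =
      shadowTerm ξ E x - if det ξ y < det ξ x then rot u else 0 := by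
  have hev := h.eventually_mem_shadow_iff_of_endpoint hξ hI hr hx
  have hx0 := hev.self_of_nhds
  have hd := hξ.det_ne_zero h.prim
  filter_upwards [hev] with y hy
  unfold shadowTerm
  rw [h.normalToward_direction hξ]
  simp only [hx0, hy, normalToward, det_swap (latticeVec u) ξ]
  rcases hd.lt_or_gt with hd' | hd'
  · by_cases hyx : det ξ y < det ξ x <;>
      simp [hd', hd'.not_gt, hyx]
  · by_cases hyx : det ξ y < det ξ x <;>
      simp [hd', hd'.not_gt, hyx, not_le.2, not_lt.1]

/-- An edge meets a line of generic direction at most once. -/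
lemma eq_of_add_smul_mem (h : IsEdgeParam E P u I) (hξ : IsGeneric ξ) {x : Plane} {r s : ℝ}
    (hr : x + r • ξ ∈ E) (hs : x + s • ξ ∈ E) : r = s :=
  ((h.add_smul_mem_iff hξ).1 hr).2.trans ((h.add_smul_mem_iff hξ).1 hs).2.symm

lemma eventually_shadowTerm_const_of_mem_interior (h : IsEdgeParam E P u I) (hξ : IsGeneric ξ)
    {x : Plane} {r t : ℝ} (hr : 0 < r) (ht : t ∈ interior I)
    (e : P + t • latticeVec u = x + r • ξ) :
    ∀ᶠ y in 𝓝 x, shadowTerm ξ E y = shadowTerm ξ E x := by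
  obtain ⟨h1, h2⟩ := (add_smul_eq_add_smul_iff (hξ.det_ne_zero h.prim) _ _ _ _).1 e.symm
  have hev := h.eventually_mem_shadow hξ (h1 ▸ ht) (h2 ▸ hr)
  have hx0 := hev.self_of_nhds
  filter_upwards [hev] with y hy
  rw [shadowTerm, shadowTerm, if_pos hy, if_pos hx0]

lemma eventually_shadowTerm_const_of_notMem (h : IsEdgeParam E P u I) (hξ : IsGeneric ξ)
    {x : Plane} (hx : x ∉ E) (hx' : ∀ r > (0 : ℝ), x + r • ξ ∉ E) :
    ∀ᶠ y in 𝓝 x, shadowTerm ξ E y = shadowTerm ξ E x := by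
  have hev := h.eventually_notMem_shadow hξ hx hx'
  have hx0 := hev.self_of_nhds
  filter_upwards [hev] with y hy
  rw [shadowTerm, shadowTerm, if_neg hy, if_neg hx0]

end IsEdgeParam

end TropicalCurve

namespace TropicalCurve

variable (L : TropicalCurve)

/-! ### Edges and vertices of a curve -/

lemma isRationalEdge_of_mem {E : Set Plane} (hE : E ∈ L.edges) : IsRationalEdge E := L.isEdge E hE

lemma exists_param {E : Set Plane} (hE : E ∈ L.edges) : ∃ P u I, IsEdgeParam E P u I :=
  (L.isEdge E hE).exists_param

variable {L}

lemma mem_extremePoints_of_mem_vertices {V : Plane} (hV : V ∈ L.vertices) {E : Set Plane}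
    (hE : E ∈ L.edges) (hVE : V ∈ E) : V ∈ E.extremePoints ℝ := by
  obtain ⟨F, hF, hVF⟩ := hV
  by_cases h : E = F
  · rwa [h]
  · exact (L.inter_subset E hE F hF h ⟨hVE, hVF.1⟩).1

lemma eq_of_mem_of_mem {x : Plane} (hx : x ∉ L.vertices) {E F : Set Plane}
    (hE : E ∈ L.edges) (hF : F ∈ L.edges) (hxE : x ∈ E) (hxF : x ∈ F) : E = F := by
  by_contra h
  exact hx ⟨E, hE, (L.inter_subset E hE F hF h ⟨hxE, hxF⟩).1⟩

variable (L)

lemma finite_vertices : L.vertices.Finite := by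
  have : L.vertices = ⋃ E ∈ L.edges, E.extremePoints ℝ := by
    ext V; simp [vertices]
  rw [this]
  refine Set.Finite.biUnion L.edges.finite_toSet fun E hE => ?_
  obtain ⟨P, u, I, h⟩ := L.exists_param hE
  exact h.finite_extremePoints

lemma isClosed_carrier : IsClosed L.carrier := by
  have : L.carrier = ⋃ E ∈ L.edges, E := by
    ext V; simp [carrier]
  rw [this]
  refine Set.Finite.isClosed_biUnion L.edges.finite_toSet fun E hE => ?_
  obtain ⟨P, u, I, h⟩ := L.exists_param hE
  exact h.isClosed

variable {L}

open scoped Classical in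
lemma exists_balanced {V : Plane} (hV : V ∈ L.vertices) : ∃ u : Set Plane → ℤ × ℤ,
    (∀ E ∈ L.edges, V ∈ E → IsPrimitiveVecAt V E (u E)) ∧
      ∑ E ∈ L.edges with V ∈ E, L.wt E • u E = 0 := by
  obtain ⟨E, hE, hVE⟩ := hV
  exact L.balanced E hE V hVE

/-! ### The potential of a curve -/

/-- The gradient of a tropical polynomial that defines the curve, up to a rotation; it vanishes far
out in the direction `ξ`. -/
noncomputable def potential (L : TropicalCurve) (ξ : Plane) (x : Plane) : ℤ × ℤ :=
  ∑ E ∈ L.edges, L.wt E • shadowTerm ξ E x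

-- `N` is the set of vertices on the open ray from `x`. The edge meets the ray at most once, so the
-- sum over `N` has at most one term: it is present if the ray hits an endpoint, and absent if it
-- hits an interior point or misses `E`.
open scoped Classical in
lemma eventually_shadowTerm_eq {ξ : Plane} (hξ : IsGeneric ξ) {x : Plane} {N : Finset Plane}
    (hN : ∀ V, V ∈ N ↔ V ∈ L.vertices ∧ ∃ r > (0 : ℝ), x + r • ξ = V) {U : Plane → Set Plane → ℤ × ℤ}
    (hU : ∀ V ∈ L.vertices, ∀ E ∈ L.edges, V ∈ E → IsPrimitiveVecAt V E (U V E))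
    {E : Set Plane} (hE : E ∈ L.edges) (hxE : x ∉ E) :
    ∀ᶠ y in 𝓝 x, shadowTerm ξ E y = shadowTerm ξ E x -
      if det ξ y < det ξ x then ∑ V ∈ N with V ∈ E, rot (U V E) else 0 := by
  obtain ⟨P, u, I, h⟩ := L.exists_param hE
  by_cases hr : ∃ r > (0 : ℝ), x + r • ξ ∈ E
  · obtain ⟨r, hr, hrE⟩ := hr
    by_cases hV : x + r • ξ ∈ L.vertices
    · have hf : N.filter (fun V => V ∈ E) = {x + r • ξ} := by
        ext V
        rw [Finset.mem_filter, Finset.mem_singleton, hN]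
        constructor
        · rintro ⟨⟨-, s, hs, rfl⟩, hVE⟩
          rw [h.eq_of_add_smul_mem hξ hVE hrE]
        · rintro rfl
          exact ⟨⟨hV, r, hr, rfl⟩, hrE⟩
      rw [hf]
      simp only [Finset.sum_singleton]
      obtain ⟨J, hJ, hJI⟩ := h.of_extremePoint (mem_extremePoints_of_mem_vertices hV hE hrE)
        (hU _ hV E hE hrE)
      exact hJ.eventually_shadowTerm_of_endpoint hξ hJI hr rfl
    · have hf : N.filter (fun V => V ∈ E) = ∅ := by
        rw [Finset.filter_eq_empty_iff]
        intro V hVN hVE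
        obtain ⟨hV', s, hs, rfl⟩ := (hN V).1 hVN
        rw [h.eq_of_add_smul_mem hξ hVE hrE] at hV'
        exact hV hV'
      obtain ⟨t, ht, e⟩ := h.mem_iff.1 hrE
      have hti : t ∈ interior I := by
        by_contra hti
        have := h.mem_extremePoints_iff.2 ⟨ht, hti⟩
        rw [e] at this
        exact hV ⟨E, hE, this⟩
      filter_upwards [h.eventually_shadowTerm_const_of_mem_interior hξ hr hti e] with y hy
      rw [hf, hy]; simp
  · push Not at hr
    have hf : N.filter (fun V => V ∈ E) = ∅ := by
      rw [Finset.filter_eq_empty_iff]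
      intro V hVN hVE
      obtain ⟨hV', s, hs, rfl⟩ := (hN V).1 hVN
      exact hr s hs hVE
    filter_upwards [h.eventually_shadowTerm_const_of_notMem hξ hxE hr] with y hy
    rw [hf, hy]; simp

open scoped Classical in
/-- The edges that do not contain `x` contribute a constant to the potential near `x`. -/
lemma eventually_sum_shadowTerm_eq (L : TropicalCurve) {ξ : Plane} (hξ : IsGeneric ξ) (x : Plane) :
    ∀ᶠ y in 𝓝 x, ∑ E ∈ L.edges with x ∉ E, L.wt E • shadowTerm ξ E y =
      ∑ E ∈ L.edges with x ∉ E, L.wt E • shadowTerm ξ E x := by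
  have hfin : {V | V ∈ L.vertices ∧ ∃ r > (0 : ℝ), x + r • ξ = V}.Finite :=
    L.finite_vertices.subset fun V hV => hV.1
  set N := hfin.toFinset with hNdef
  have hN : ∀ V, V ∈ N ↔ V ∈ L.vertices ∧ ∃ r > (0 : ℝ), x + r • ξ = V := fun V => by
    rw [hNdef, Set.Finite.mem_toFinset]; rfl
  have hex : ∀ V : Plane, ∃ u : Set Plane → ℤ × ℤ, V ∈ L.vertices →
      (∀ E ∈ L.edges, V ∈ E → IsPrimitiveVecAt V E (u E)) ∧
        ∑ E ∈ L.edges with V ∈ E, L.wt E • u E = 0 := by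
    intro V
    by_cases hV : V ∈ L.vertices
    · obtain ⟨u, hu⟩ := exists_balanced hV
      exact ⟨u, fun _ => hu⟩
    · exact ⟨0, fun h => absurd h hV⟩
  choose U hU using hex
  -- Exchanging the two sums leaves, for every vertex on the ray, the rotated balancing condition.
  have key : ∑ E ∈ L.edges with x ∉ E, L.wt E • ∑ V ∈ N with V ∈ E, rot (U V E) = 0 := by
    -- The edges through `x` may be added: they already meet the line in `x`, so they contain no
    -- vertex of the open ray.
    have h1 : ∑ E ∈ L.edges with x ∉ E, L.wt E • ∑ V ∈ N with V ∈ E, rot (U V E) =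
        ∑ E ∈ L.edges, L.wt E • ∑ V ∈ N with V ∈ E, rot (U V E) := by
      apply Finset.sum_filter_of_ne
      intro E hE hne hxE
      apply hne
      obtain ⟨P, u, I, h⟩ := L.exists_param hE
      rw [Finset.filter_false_of_mem, Finset.sum_empty, smul_zero]
      intro V hVN hVE
      obtain ⟨-, s, hs, rfl⟩ := (hN V).1 hVN
      exact hs.ne (h.eq_of_add_smul_mem hξ (x := x) (r := 0) (by simpa using hxE) hVE)
    rw [h1]
    simp_rw [Finset.smul_sum, Finset.sum_filter]
    rw [Finset.sum_comm]
    apply Finset.sum_eq_zero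
    intro V hV
    have h2 := (hU V ((hN V).1 hV).1).2
    rw [← Finset.sum_filter]
    have h3 := congrArg rot h2
    rw [map_sum, map_zero] at h3
    simpa only [map_nsmul] using h3
  have hev : ∀ᶠ y in 𝓝 x, ∀ E ∈ L.edges.filter (fun E => x ∉ E), shadowTerm ξ E y =
      shadowTerm ξ E x - if det ξ y < det ξ x then ∑ V ∈ N with V ∈ E, rot (U V E) else 0 := by
    rw [Filter.eventually_all_finset]
    intro E hE
    rw [Finset.mem_filter] at hE
    exact eventually_shadowTerm_eq hξ hN (fun V hV => (hU V hV).1) hE.1 hE.2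
  filter_upwards [hev] with y hy
  rw [Finset.sum_congr rfl fun E hE => by rw [hy E hE]]
  split_ifs
  · simp_rw [smul_sub]
    rw [Finset.sum_sub_distrib, key, sub_zero]
  · simp

lemma eventually_potential_eq {ξ : Plane} (hξ : IsGeneric ξ) {x : Plane} (hx : x ∉ L.carrier) :
    ∀ᶠ y in 𝓝 x, L.potential ξ y = L.potential ξ x := by
  classical
  have hf : L.edges.filter (fun E => x ∉ E) = L.edges := by
    rw [Finset.filter_true_of_mem]
    intro E hE hxE
    exact hx ⟨E, hE, hxE⟩
  have := L.eventually_sum_shadowTerm_eq hξ x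
  rw [hf] at this
  exact this

lemma exists_mem_interior_of_notMem_vertices {x : Plane} (hx : x ∉ L.vertices) {E : Set Plane}
    (hE : E ∈ L.edges) (hxE : x ∈ E) {P u I} (h : IsEdgeParam E P u I) :
    ∃ t ∈ interior I, P + t • latticeVec u = x := by
  obtain ⟨t, ht, rfl⟩ := h.mem_iff.1 hxE
  refine ⟨t, ?_, rfl⟩
  by_contra hti
  exact hx ⟨E, hE, h.mem_extremePoints_iff.2 ⟨ht, hti⟩⟩

/-- Near an interior point the edge fills its line, and the shadow is the side from which `ξ` points
at that line. Exactly one of the two points lies there, and the sign in `normalToward` makes the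
difference `n` for both choices of `n`. -/
lemma IsEdgeParam.eventually_shadowTerm_sub {E : Set Plane} {P : Plane} {u : ℤ × ℤ} {I : Set ℝ}
    (h : IsEdgeParam E P u I) {ξ : Plane} (hξ : IsGeneric ξ) {x : Plane} {t : ℝ}
    (ht : t ∈ interior I) (hx : P + t • latticeVec u = x) {n : ℤ × ℤ} (hn : n = rot u ∨ n = -rot u) :
    ∀ᶠ s : ℝ in 𝓝[>] 0, shadowTerm ξ E (x + s • latticeVec n) -
      shadowTerm ξ E (x - s • latticeVec n) = n := by
  have hd := hξ.det_ne_zero h.prim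
  have hu := dot_self_pos h.prim.latticeVec_ne_zero
  obtain ⟨h1, h2⟩ := (add_smul_eq_add_smul_iff hd x P 0 t).1 (by simp [hx])
  have hev : ∀ᶠ y in 𝓝 x, (y ∈ shadow ξ E ↔
      0 < det (latticeVec u) (y - x) / det ξ (latticeVec u)) := by
    have c1 := (IsEdgeParam.continuous_coord P (det ξ (latticeVec u)) ξ).continuousAt.eventually
      (isOpen_interior.mem_nhds (h1 ▸ ht))
    filter_upwards [c1] with y hy
    have hy2 := h.exists_mem_lt_of_mem_interior hξ hy
    have e : det (latticeVec u) (y - x) = det (latticeVec u) (y - P) := by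
      rw [← hx]; simp only [det_sub_right, det_add_right, det_smul_right, det_self]; ring
    rw [h.mem_shadow_iff hξ, e]
    exact ⟨fun h => h.2.1, fun h => ⟨interior_subset hy, h, hy2⟩⟩
  have t1 : Tendsto (fun s : ℝ => x + s • latticeVec n) (𝓝[>] 0) (𝓝 x) := by
    have : Continuous fun s : ℝ => x + s • latticeVec n := by fun_prop
    simpa using (this.tendsto 0).mono_left nhdsWithin_le_nhds
  have t2 : Tendsto (fun s : ℝ => x - s • latticeVec n) (𝓝[>] 0) (𝓝 x) := by
    have : Continuous fun s : ℝ => x - s • latticeVec n := by fun_prop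
    simpa using (this.tendsto 0).mono_left nhdsWithin_le_nhds
  filter_upwards [t1.eventually hev, t2.eventually hev, self_mem_nhdsWithin] with s h1 h2 hs
  have hs : 0 < s := hs
  have e1 : det (latticeVec u) (latticeVec (rot u)) = dot (latticeVec u) (latticeVec u) := by
    simp [det, dot]
  unfold shadowTerm
  rw [h.normalToward_direction hξ]
  simp only [h1, h2, normalToward, add_sub_cancel_left, sub_sub_cancel_left, det_neg_right,
    det_smul_right, det_swap (latticeVec u) ξ]
  have hpos := mul_pos hs hu
  rcases hn with rfl | rfl <;> rcases hd.lt_or_gt with hd' | hd'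
  · have a1 := div_neg_of_pos_of_neg hpos hd'
    simp [e1, hd', neg_div, a1, a1.not_gt]
  · have a1 := div_pos hpos hd'
    simp [e1, hd'.not_gt, neg_div, a1, a1.not_gt]
  · have a1 := div_neg_of_pos_of_neg hpos hd'
    simp [e1, hd', neg_div, a1, a1.not_gt, det_neg_right]
  · have a1 := div_pos hpos hd'
    simp [e1, hd'.not_gt, neg_div, a1, a1.not_gt, det_neg_right]

/-- The potential jumps along each edge by the weighted normal vector. -/
lemma eventually_potential_sub {ξ : Plane} (hξ : IsGeneric ξ) {x : Plane} (hx : x ∉ L.vertices)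
    {E : Set Plane} (hE : E ∈ L.edges) (hxE : x ∈ E) {n : ℤ × ℤ} {P u I}
    (h : IsEdgeParam E P u I) (hn : n = rot u ∨ n = -rot u) :
    ∀ᶠ s : ℝ in 𝓝[>] 0, L.potential ξ (x + s • latticeVec n) -
      L.potential ξ (x - s • latticeVec n) = L.wt E • n := by
  classical
  obtain ⟨t, ht, e⟩ := exists_mem_interior_of_notMem_vertices hx hE hxE h
  -- Off the vertices only `E` passes through `x`; all other edges together contribute a locally
  -- constant sum.
  have hf : L.edges.filter (fun E => ¬ x ∉ E) = {E} := by
    ext F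
    rw [Finset.mem_filter, Finset.mem_singleton, not_not]
    exact ⟨fun hF => eq_of_mem_of_mem hx hF.1 hE hF.2 hxE, fun hF => hF ▸ ⟨hE, hxE⟩⟩
  have hsplit : ∀ y, L.potential ξ y = ∑ E ∈ L.edges with x ∉ E, L.wt E • shadowTerm ξ E y +
      L.wt E • shadowTerm ξ E y := by
    intro y
    rw [potential, ← Finset.sum_filter_add_sum_filter_not L.edges (fun E => x ∉ E), hf,
      Finset.sum_singleton]
  have hev := L.eventually_sum_shadowTerm_eq hξ x
  have t1 : Tendsto (fun s : ℝ => x + s • latticeVec n) (𝓝[>] 0) (𝓝 x) := by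
    have : Continuous fun s : ℝ => x + s • latticeVec n := by fun_prop
    simpa using (this.tendsto 0).mono_left nhdsWithin_le_nhds
  have t2 : Tendsto (fun s : ℝ => x - s • latticeVec n) (𝓝[>] 0) (𝓝 x) := by
    have : Continuous fun s : ℝ => x - s • latticeVec n := by fun_prop
    simpa using (this.tendsto 0).mono_left nhdsWithin_le_nhds
  filter_upwards [t1.eventually hev, t2.eventually hev, h.eventually_shadowTerm_sub hξ ht e hn]
    with s h1 h2 h3
  rw [hsplit, hsplit, h1, h2, add_sub_add_left_eq_sub, ← smul_sub, h3]

end TropicalCurve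

namespace TropicalCurve

/-! ### Newton complexes -/

/-- The region of a point off the curve. -/
def regionOf (L : TropicalCurve) {x : Plane} (hx : x ∉ L.carrier) : L.Region :=
  ConnectedComponents.mk (⟨x, hx⟩ : ↥(L.carrierᶜ))

variable {L : TropicalCurve}

lemma exists_regionOf_eq (i : L.Region) : ∃ (x : Plane) (hx : x ∉ L.carrier), L.regionOf hx = i := by
  obtain ⟨⟨x, hx⟩, rfl⟩ := ConnectedComponents.surjective_coe i
  exact ⟨x, hx, rfl⟩

lemma regionOf_eq_of_isPreconnected {C : Set Plane} (hC : IsPreconnected C)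
    (hCL : ∀ x ∈ C, x ∉ L.carrier) {x y : Plane} (hx : x ∈ C) (hy : y ∈ C) :
    L.regionOf (hCL x hx) = L.regionOf (hCL y hy) := by
  unfold regionOf
  rw [ConnectedComponents.coe_eq_coe']
  have h1 : IsPreconnected ((Subtype.val : ↥(L.carrierᶜ) → Plane) ⁻¹' C) := by
    rw [← Topology.IsInducing.subtypeVal.isPreconnected_image, Subtype.image_preimage_coe,
      Set.inter_eq_self_of_subset_right (show C ⊆ L.carrierᶜ from hCL)]
    exact hC
  have hx' : (⟨x, hCL x hx⟩ : ↥(L.carrierᶜ)) ∈ (Subtype.val ⁻¹' C : Set ↥(L.carrierᶜ)) := hx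
  have hy' : (⟨y, hCL y hy⟩ : ↥(L.carrierᶜ)) ∈ (Subtype.val ⁻¹' C : Set ↥(L.carrierᶜ)) := hy
  exact h1.subset_connectedComponent hy' hx'

lemma eq_rot_or_eq_neg_rot {E : Set Plane} {P : Plane} {u : ℤ × ℤ} {I : Set ℝ}
    (h : IsEdgeParam E P u I) {n : ℤ × ℤ} (hn : IsPrimitiveVec n)
    (ho : ∀ x ∈ E, ∀ y ∈ E, (x.1 - y.1) * (n.1 : ℝ) + (x.2 - y.2) * (n.2 : ℝ) = 0) :
    n = rot u ∨ n = -rot u := by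
  apply h.prim.rot.eq_or_eq_neg hn
  obtain ⟨t, ht, ht0⟩ := h.exists_pos_mem_dom
  have := ho _ (h.mem ht) _ h.base_mem
  simp only [Prod.fst_add, Prod.snd_add, Prod.smul_fst, Prod.smul_snd, smul_eq_mul,
    latticeVec_fst, latticeVec_snd, add_sub_cancel_left] at this
  have h2 : t * det (latticeVec (rot u)) (latticeVec n) = 0 := by
    simp only [det, latticeVec_fst, latticeVec_snd, rot_fst, rot_snd]
    push_cast
    linarith
  exact (mul_eq_zero.1 h2).resolve_left ht0.ne'

/-- The potential in a generic direction descends to a Newton complex. -/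
lemma exists_isNewtonComplex_of_potential {ξ : Plane} (hξ : IsGeneric ξ) :
    ∃ w : L.Region → ℤ × ℤ, L.IsNewtonComplex w ∧
      ∀ (x : Plane) (hx : x ∉ L.carrier), w (L.regionOf hx) = L.potential ξ x := by
  have hlc : IsLocallyConstant fun x : ↥(L.carrierᶜ) => L.potential ξ x := by
    rw [IsLocallyConstant.iff_eventually_eq]
    rintro ⟨x, hx⟩
    exact (continuous_subtype_val.tendsto (⟨x, hx⟩ : ↥(L.carrierᶜ))).eventually
      (eventually_potential_eq hξ (x := x) hx)
  have hw : ∀ i : L.Region, ∃ c : ℤ × ℤ, ∀ (x : Plane) (hx : x ∉ L.carrier),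
      L.regionOf hx = i → c = L.potential ξ x := by
    intro i
    obtain ⟨y, hy, rfl⟩ := exists_regionOf_eq i
    refine ⟨L.potential ξ y, fun x hx e => ?_⟩
    have := ConnectedComponents.coe_eq_coe'.1 e.symm
    exact hlc.apply_eq_of_isPreconnected isPreconnected_connectedComponent this
      mem_connectedComponent
  choose w hw using hw
  refine ⟨w, ?_, fun x hx => hw _ x hx rfl⟩
  rintro E hE i j n ⟨hn, ho, x, ⟨hxE, hxV⟩, hev⟩
  obtain ⟨P, u, I, h⟩ := L.exists_param hE
  obtain ⟨s, ⟨⟨h1, h1'⟩, ⟨h2, h2'⟩⟩, h3⟩ :=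
    (hev.and (eventually_potential_sub hξ hxV hE hxE h (eq_rot_or_eq_neg_rot h hn ho))).exists
  rw [hw i _ h1 h1', hw j _ h2 h2', h3]

/-- Near a point of the interior of an edge, the curve is a line. -/
lemma exists_ball_mem_carrier_iff {x : Plane} (hx : x ∉ L.vertices) {E : Set Plane}
    (hE : E ∈ L.edges) (hxE : x ∈ E) {P u I} (h : IsEdgeParam E P u I) :
    ∃ δ > (0 : ℝ), ∀ y ∈ Metric.ball x δ, (y ∈ L.carrier ↔ det (latticeVec u) (y - x) = 0) := by
  obtain ⟨t, ht, e⟩ := exists_mem_interior_of_notMem_vertices hx hE hxE h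
  have h0 := (dot_self_pos h.prim.latticeVec_ne_zero).ne'
  have hother : ∀ᶠ y in 𝓝 x, ∀ F ∈ L.edges, F ≠ E → y ∉ F := by
    rw [Filter.eventually_all_finset]
    intro F hF
    by_cases hFE : F = E
    · simp [hFE]
    · obtain ⟨Q, v, J, hF'⟩ := L.exists_param hF
      have : x ∉ F := fun hxF => hFE (eq_of_mem_of_mem hx hF hE hxF hxE)
      filter_upwards [hF'.isClosed.isOpen_compl.mem_nhds this] with y hy _ using hy
  have hc : Continuous fun y : Plane =>
      dot (latticeVec u) (y - P) / dot (latticeVec u) (latticeVec u) := by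
    unfold dot; fun_prop
  have hint : ∀ᶠ y in 𝓝 x,
      dot (latticeVec u) (y - P) / dot (latticeVec u) (latticeVec u) ∈ interior I := by
    apply hc.continuousAt.eventually (isOpen_interior.mem_nhds _)
    dsimp only
    rw [← e, add_sub_cancel_left, dot_smul_right, mul_div_cancel_right₀ _ h0]
    exact ht
  obtain ⟨δ, hδ, hb⟩ := Metric.eventually_nhds_iff_ball.1 (hother.and hint)
  refine ⟨δ, hδ, fun y hy => ?_⟩
  have e2 : det (latticeVec u) (y - x) = det (latticeVec u) (y - P) := by
    rw [← e]; simp only [det_sub_right, det_add_right, det_smul_right, det_self]; ring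
  rw [e2]
  constructor
  · rintro ⟨F, hF, hyF⟩
    by_cases hFE : F = E
    · subst hFE
      exact (h.mem_iff_det.1 hyF).1
    · exact absurd hyF ((hb y hy).1 F hF hFE)
  · intro hd
    exact ⟨E, hE, h.mem_iff_det.2 ⟨hd, interior_subset (hb y hy).2⟩⟩

lemma convex_ball_inter_setOf_lt_det (x U : Plane) (δ : ℝ) :
    Convex ℝ (Metric.ball x δ ∩ {y | 0 < det U (y - x)}) := by
  refine (convex_ball x δ).inter ?_
  intro y hy z hz a b ha hb hab
  simp only [Set.mem_ofPred_eq] at hy hz ⊢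
  have : a • y + b • z - x = a • (y - x) + b • (z - x) := by
    have hb' : b = 1 - a := by linarith
    subst hb'
    ext <;> simp <;> ring
  rw [this, det_add_right, det_smul_right, det_smul_right]
  rcases ha.eq_or_lt with rfl | ha
  · have : b = 1 := by linarith
    subst this; simpa using hz
  · have := mul_pos ha hy
    have := mul_nonneg hb hz.le
    linarith

/-- Near a point of the interior of an edge, there are two regions. -/
lemma exists_isNormalFromTo {x : Plane} (hx : x ∉ L.vertices) {E : Set Plane}
    (hE : E ∈ L.edges) (hxE : x ∈ E) {P u I} (h : IsEdgeParam E P u I) :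
    ∃ i j : L.Region, L.IsNormalFromTo E i j (rot u) ∧
      ∀ᶠ y in 𝓝 x, ∀ hy : y ∉ L.carrier, L.regionOf hy = i ∨ L.regionOf hy = j := by
  obtain ⟨δ, hδ, hb⟩ := exists_ball_mem_carrier_iff hx hE hxE h
  have hC1 : ∀ y ∈ Metric.ball x δ ∩ {y | 0 < det (-latticeVec u) (y - x)}, y ∉ L.carrier := by
    rintro y ⟨hy, hy'⟩ hyL
    simp only [Set.mem_ofPred_eq, det_neg_left] at hy'
    linarith [(hb y hy).1 hyL]
  have hC2 : ∀ y ∈ Metric.ball x δ ∩ {y | 0 < det (latticeVec u) (y - x)}, y ∉ L.carrier := by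
    rintro y ⟨hy, hy'⟩ hyL
    simp only [Set.mem_ofPred_eq] at hy'
    linarith [(hb y hy).1 hyL]
  have hu := dot_self_pos h.prim.latticeVec_ne_zero
  have e1 : det (latticeVec u) (latticeVec (rot u)) = dot (latticeVec u) (latticeVec u) := by
    simp [det, dot]
  have t1 : Tendsto (fun s : ℝ => x + s • latticeVec (rot u)) (𝓝[>] 0) (𝓝 x) := by
    have : Continuous fun s : ℝ => x + s • latticeVec (rot u) := by fun_prop
    simpa using (this.tendsto 0).mono_left nhdsWithin_le_nhds
  have t2 : Tendsto (fun s : ℝ => x - s • latticeVec (rot u)) (𝓝[>] 0) (𝓝 x) := by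
    have : Continuous fun s : ℝ => x - s • latticeVec (rot u) := by fun_prop
    simpa using (this.tendsto 0).mono_left nhdsWithin_le_nhds
  have hball := Metric.ball_mem_nhds x hδ
  have hev : ∀ᶠ s : ℝ in 𝓝[>] 0,
      x - s • latticeVec (rot u) ∈ Metric.ball x δ ∩ {y | 0 < det (-latticeVec u) (y - x)} ∧
      x + s • latticeVec (rot u) ∈ Metric.ball x δ ∩ {y | 0 < det (latticeVec u) (y - x)} := by
    filter_upwards [t1.eventually hball, t2.eventually hball, self_mem_nhdsWithin] with s h1 h2 hs
    have hpos := mul_pos (Set.mem_Ioi.1 hs) hu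
    refine ⟨⟨h2, ?_⟩, h1, ?_⟩
    · simpa [det_neg_left, det_neg_right, det_smul_right, e1] using hpos
    · simpa [det_smul_right, e1] using hpos
  obtain ⟨s, hs1, hs2⟩ := hev.exists
  have hp1 := (convex_ball_inter_setOf_lt_det x (-latticeVec u) δ).isPreconnected
  have hp2 := (convex_ball_inter_setOf_lt_det x (latticeVec u) δ).isPreconnected
  refine ⟨L.regionOf (hC1 _ hs1), L.regionOf (hC2 _ hs2), ⟨h.prim.rot, ?_, x, ⟨hxE, hx⟩, ?_⟩, ?_⟩
  · intro y hy z hz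
    have := h.det_sub hy hz
    simp only [det, latticeVec_fst, latticeVec_snd, Prod.fst_sub, Prod.snd_sub, rot_fst,
      rot_snd] at this ⊢
    push_cast
    linarith
  · filter_upwards [hev] with r hr
    exact ⟨⟨hC1 _ hr.1, regionOf_eq_of_isPreconnected hp1 hC1 hr.1 hs1⟩,
      ⟨hC2 _ hr.2, regionOf_eq_of_isPreconnected hp2 hC2 hr.2 hs2⟩⟩
  · filter_upwards [hball] with y hy hyL
    have hne : det (latticeVec u) (y - x) ≠ 0 := fun h0 => hyL ((hb y hy).2 h0)
    rcases hne.lt_or_gt with h1 | h1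
    · left
      exact regionOf_eq_of_isPreconnected hp1 hC1 ⟨hy, by
        simp only [Set.mem_ofPred_eq, det_neg_left]; linarith⟩ hs1
    · right
      exact regionOf_eq_of_isPreconnected hp2 hC2 ⟨hy, h1⟩ hs2

/-- Local values of a function on the regions can therefore be compared at points arbitrarily close
to a point of an edge. -/
lemma frequently_notMem_carrier {x : Plane} (hx : x ∉ L.vertices) : ∃ᶠ y in 𝓝 x, y ∉ L.carrier := by
  by_cases hxL : x ∈ L.carrier
  · obtain ⟨E, hE, hxE⟩ := hxL
    obtain ⟨P, u, I, h⟩ := L.exists_param hE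
    obtain ⟨δ, hδ, hb⟩ := exists_ball_mem_carrier_iff hx hE hxE h
    have t1 : Tendsto (fun s : ℝ => x + s • latticeVec (rot u)) (𝓝[>] 0) (𝓝 x) := by
      have : Continuous fun s : ℝ => x + s • latticeVec (rot u) := by fun_prop
      simpa using (this.tendsto 0).mono_left nhdsWithin_le_nhds
    apply t1.frequently
    apply Filter.Eventually.frequently
    filter_upwards [t1.eventually (Metric.ball_mem_nhds x hδ), self_mem_nhdsWithin] with s h1 hs hL
    have := (hb _ h1).1 hL
    have hu := dot_self_pos h.prim.latticeVec_ne_zero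
    have e1 : det (latticeVec u) (latticeVec (rot u)) = dot (latticeVec u) (latticeVec u) := by
      simp [det, dot]
    rw [add_sub_cancel_left, det_smul_right, e1] at this
    exact (mul_pos (Set.mem_Ioi.1 hs) hu).ne' this
  · have : ∀ᶠ y in 𝓝 x, y ∉ L.carrier := L.isClosed_carrier.isOpen_compl.mem_nhds hxL
    exact this.frequently

/-- A function on the set of regions which takes the same value on adjacent regions is constant. -/
lemma eq_of_forall_isNormalFromTo {α : Type*} {g : L.Region → α}
    (hg : ∀ E ∈ L.edges, ∀ i j n, L.IsNormalFromTo E i j n → g i = g j) (i j : L.Region) :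
    g i = g j := by
  -- `g` extends over the interiors of the edges, where it has the same value on both sides. The
  -- extension is locally constant on the plane without the vertices.
  have hloc : ∀ x : ↥(L.verticesᶜ), ∃ c, ∀ᶠ y in 𝓝 (x : Plane),
      ∀ hy : y ∉ L.carrier, g (L.regionOf hy) = c := by
    rintro ⟨x, hx⟩
    by_cases hxL : x ∈ L.carrier
    · obtain ⟨E, hE, hxE⟩ := hxL
      obtain ⟨P, u, I, h⟩ := L.exists_param hE
      obtain ⟨i, j, hij, hev⟩ := exists_isNormalFromTo hx hE hxE h
      refine ⟨g i, ?_⟩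
      filter_upwards [hev] with y hy hyL
      rcases hy hyL with h1 | h1
      · rw [h1]
      · rw [h1, hg E hE i j _ hij]
    · refine ⟨g (L.regionOf hxL), ?_⟩
      obtain ⟨δ, hδ, hb⟩ := Metric.isOpen_iff.1 L.isClosed_carrier.isOpen_compl x hxL
      filter_upwards [Metric.ball_mem_nhds x hδ] with y hy hyL
      rw [regionOf_eq_of_isPreconnected (convex_ball x δ).isPreconnected hb hy
        (Metric.mem_ball_self hδ)]
  choose F hF using hloc
  have hlc : IsLocallyConstant F := by
    rw [IsLocallyConstant.iff_eventually_eq]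
    intro x
    filter_upwards [(continuous_subtype_val.tendsto x).eventually
      (eventually_eventually_nhds.2 (hF x))] with x' hx'
    obtain ⟨y, hyL, h1, h2⟩ := ((frequently_notMem_carrier x'.2).and_eventually
      (hx'.and (hF x'))).exists
    rw [← h1 hyL, ← h2 hyL]
  have hval : ∀ (x : Plane) (hx : x ∉ L.carrier), ∃ hx' : x ∈ L.verticesᶜ,
      g (L.regionOf hx) = F ⟨x, hx'⟩ := by
    intro x hx
    have hx' : x ∈ L.verticesᶜ := by
      rintro ⟨E, hE, hxE⟩
      exact hx ⟨E, hE, hxE.1⟩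
    exact ⟨hx', (hF ⟨x, hx'⟩).self_of_nhds hx⟩
  -- Removing finitely many points does not disconnect the plane.
  have hconn : PreconnectedSpace ↥(L.verticesᶜ) := by
    rw [← isPreconnected_iff_preconnectedSpace]
    have hrank : 1 < Module.rank ℝ Plane := by
      rw [← Module.finrank_eq_rank]
      simp
    exact (L.finite_vertices.countable.isPathConnected_compl_of_one_lt_rank
      hrank).isConnected.isPreconnected
  obtain ⟨x, hx, rfl⟩ := exists_regionOf_eq i
  obtain ⟨y, hy, rfl⟩ := exists_regionOf_eq j
  obtain ⟨hx', h1⟩ := hval x hx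
  obtain ⟨hy', h2⟩ := hval y hy
  rw [h1, h2]
  exact hlc.apply_eq_of_preconnectedSpace _ _

/-- Both complexes have the same jump across each edge, so their difference agrees on adjacent
regions. -/
lemma IsNewtonComplex.sub_eq_sub {w w' : L.Region → ℤ × ℤ} (hw : L.IsNewtonComplex w)
    (hw' : L.IsNewtonComplex w') (i j : L.Region) : w i - w' i = w j - w' j := by
  refine eq_of_forall_isNormalFromTo (g := fun i => w i - w' i) ?_ i j
  intro E hE i j n h
  have h1 := hw E hE i j n h
  have h2 := hw' E hE i j n h
  have h3 : w j - w i = w' j - w' i := h1.trans h2.symm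
  rw [sub_eq_sub_iff_add_eq_add] at h3 ⊢
  rw [add_comm, ← h3, add_comm]

/-- A Newton complex is determined by each of the potentials up to translation. -/
lemma IsNewtonComplex.exists_eq_potential_add {w : L.Region → ℤ × ℤ} (hw : L.IsNewtonComplex w)
    {ξ : Plane} (hξ : IsGeneric ξ) : ∃ c, ∀ (x : Plane) (hx : x ∉ L.carrier),
      w (L.regionOf hx) = L.potential ξ x + c := by
  obtain ⟨w', hw', h⟩ := exists_isNewtonComplex_of_potential (L := L) hξ
  by_cases hne : ∃ x, x ∉ L.carrier
  · obtain ⟨x₀, hx₀⟩ := hne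
    refine ⟨w (L.regionOf hx₀) - w' (L.regionOf hx₀), fun x hx => ?_⟩
    rw [← h x hx, hw.sub_eq_sub hw' _ (L.regionOf hx)]; abel
  · push Not at hne
    exact ⟨0, fun x hx => absurd (hne x) hx⟩

/-- The potential depends only on the set of edges in whose shadow the point lies. -/
lemma finite_range_potential (L : TropicalCurve) (ξ : Plane) :
    (Set.range (L.potential ξ)).Finite := by
  classical
  refine (L.edges.powerset.image fun S =>
    ∑ E ∈ S, L.wt E • -normalToward ξ (direction E)).finite_toSet.subset ?_
  rintro _ ⟨x, rfl⟩
  rw [Finset.mem_coe, Finset.mem_image]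
  refine ⟨L.edges.filter fun E => x ∈ shadow ξ E, by simp, ?_⟩
  rw [Finset.sum_filter, potential]
  refine Finset.sum_congr rfl fun E _ => ?_
  unfold shadowTerm
  split_ifs <;> simp

lemma IsNewtonComplex.finite_range {w : L.Region → ℤ × ℤ} (hw : L.IsNewtonComplex w) :
    (Set.range w).Finite := by
  obtain ⟨c, hc⟩ := hw.exists_eq_potential_add isGeneric_one_sqrt_two
  refine ((L.finite_range_potential (1, √2)).image (· + c)).subset ?_
  rintro _ ⟨i, rfl⟩
  obtain ⟨x, hx, rfl⟩ := exists_regionOf_eq i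
  exact ⟨_, ⟨x, rfl⟩, (hc x hx).symm⟩

end TropicalCurve

namespace TropicalCurve

/-! ### The asymptotic directions of a curve -/

/-- The total weight of the unbounded edges in each direction (a line has two directions). -/
noncomputable def endWeight (L : TropicalCurve) : (ℤ × ℤ) →₀ ℕ :=
  ∑ E ∈ L.edges, ∑ u ∈ ends E, Finsupp.single u (L.wt E)

/-- The left side is additive in the weight function. Regrouping by edges makes it comparable with
`potential`, which is a sum over edges. -/
lemma endWeight_sum {M : Type*} [AddCommMonoid M] (L : TropicalCurve) (f : ℤ × ℤ → M) :
    (L.endWeight.sum fun u d => d • f u) = ∑ E ∈ L.edges, ∑ u ∈ ends E, L.wt E • f u := by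
  have h : ∀ g : (ℤ × ℤ) →₀ ℕ, (g.sum fun u d => d • f u) =
      Finsupp.liftAddHom (fun u => (multiplesHom M) (f u)) g := fun g => by
    rw [Finsupp.liftAddHom_apply]; rfl
  rw [h, endWeight]
  simp only [map_sum]
  refine Finset.sum_congr rfl fun E _ => Finset.sum_congr rfl fun u _ => ?_
  rw [Finsupp.liftAddHom_apply_single]; rfl

lemma isPrimitiveVec_of_mem_support (L : TropicalCurve) {u : ℤ × ℤ}
    (hu : u ∈ L.endWeight.support) : IsPrimitiveVec u := by
  classical
  rw [Finsupp.mem_support_iff, endWeight, Finsupp.finsetSum_apply] at hu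
  obtain ⟨E, -, hE⟩ := Finset.exists_ne_zero_of_sum_ne_zero hu
  rw [Finsupp.finsetSum_apply] at hE
  obtain ⟨v, hv, hne⟩ := Finset.exists_ne_zero_of_sum_ne_zero hE
  rw [Finsupp.single_apply] at hne
  split_ifs at hne with h
  · exact h ▸ isPrimitiveVec_of_mem_ends hv
  · exact absurd rfl hne

open scoped Classical in
/-- The rotated vector, if it lies in the cone spanned by `ξ` and `v`. -/
noncomputable def coneRot (ξ v : Plane) (u : ℤ × ℤ) : ℤ × ℤ :=
  if 0 < det ξ (latticeVec u) ∧ 0 < det (latticeVec u) v then rot u else 0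

lemma eventually_lt_mul_add {a : ℝ} (ha : 0 < a) (b M : ℝ) : ∀ᶠ s : ℝ in atTop, M < s * a + b := by
  filter_upwards [eventually_gt_atTop ((M - b) / a)] with s hs
  rw [div_lt_iff₀ ha] at hs
  linarith

lemma eventually_mul_add_lt {a : ℝ} (ha : a < 0) (b M : ℝ) : ∀ᶠ s : ℝ in atTop, s * a + b < M := by
  filter_upwards [eventually_lt_mul_add (neg_pos.2 ha) (-b) (-M)] with s hs
  linarith

lemma det_smul_sub_div (a ξ P : Plane) (d s : ℝ) :
    det a (s • ξ - P) / d = s * (det a ξ / d) + -(det a P / d) := by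
  rw [det_sub_right, det_smul_right]; ring

namespace IsEdgeParam

variable {E : Set Plane} {P : Plane} {u : ℤ × ℤ} {I : Set ℝ} {ξ v : Plane}

/-- Seen from a point far out along `ξ`, the ray in the direction `v` crosses exactly the edges with
an end in the open cone between `ξ` and `v`. -/
lemma eventually_shadowTerm_far (h : IsEdgeParam E P u I) (hv : IsGeneric v) (hξ : IsGeneric ξ)
    (hξv : 0 < det ξ v) :
    ∀ᶠ s : ℝ in atTop, shadowTerm v E (s • ξ) = -∑ u ∈ ends E, coneRot ξ v u := by
  have hd := hv.det_ne_zero h.prim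
  have hb := hξ.det_ne_zero' h.prim
  have hA : det v ξ < 0 := by rw [det_swap]; linarith
  have hin : ∀ {s : ℝ}, det v (s • ξ - P) / det v (latticeVec u) ∈ interior I →
      0 < det (latticeVec u) (s • ξ - P) / det v (latticeVec u) →
      shadowTerm v E (s • ξ) = -normalToward v u := by
    intro s h1 h2
    rw [shadowTerm, if_pos (h.eventually_mem_shadow hv h1 h2).self_of_nhds,
      h.normalToward_direction hv]
  have hout : ∀ {s : ℝ}, (det v (s • ξ - P) / det v (latticeVec u) ∈ I →
      ¬ 0 < det (latticeVec u) (s • ξ - P) / det v (latticeVec u)) →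
      shadowTerm v E (s • ξ) = 0 := by
    intro s h1
    rw [shadowTerm, if_neg]
    intro h2
    obtain ⟨h3, h4, -⟩ := (h.mem_shadow_iff hv).1 h2
    exact h1 h3 h4
  -- The position of the crossing on the ray is affine in `s`, so its sign is eventually that of its
  -- slope.
  have hr : ∀ᶠ s : ℝ in atTop, (0 < det (latticeVec u) (s • ξ - P) / det v (latticeVec u) ↔
      0 < det (latticeVec u) ξ / det v (latticeVec u)) := by
    rcases (div_ne_zero hb hd).lt_or_gt with h1 | h1
    · filter_upwards [eventually_mul_add_lt h1 (-(det (latticeVec u) P / det v (latticeVec u))) 0]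
        with s hs
      rw [← det_smul_sub_div] at hs
      exact iff_of_false hs.not_gt h1.not_gt
    · filter_upwards [eventually_lt_mul_add h1 (-(det (latticeVec u) P / det v (latticeVec u))) 0]
        with s hs
      rw [← det_smul_sub_div] at hs
      exact iff_of_true hs h1
  have e1 : det ξ (latticeVec u) = -det (latticeVec u) ξ := det_swap _ _
  have e2 : det (latticeVec u) v = -det v (latticeVec u) := det_swap _ _
  -- The crossing parameter on the edge tends to `+∞` in the first case and to `-∞` in the second.
  -- Segments are eventually missed in both, and rays in the second, where a line can be met only at
  -- its end `-u`.
  rcases hd.lt_or_gt with hd' | hd'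
  · have ha := div_pos_of_neg_of_neg hA hd'
    have hn : normalToward v u = rot u := by rw [normalToward, if_pos (by linarith)]
    have ht := eventually_lt_mul_add ha (-(det v P / det v (latticeVec u)))
    simp_rw [← det_smul_sub_div] at ht
    have hu : coneRot ξ v u =
        if 0 < det (latticeVec u) ξ / det v (latticeVec u) then rot u else 0 := by
      rw [coneRot]
      congr 1
      rw [e1, e2, div_pos_iff]
      apply propext
      constructor
      · rintro ⟨h1, -⟩; exact Or.inr ⟨by linarith, hd'⟩
      · rintro (h1 | h1) <;> constructor <;> linarith
    rcases h.dom with ⟨l, hl, rfl⟩ | rfl | rfl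
    · rw [h.ends_segment]
      filter_upwards [ht l] with s hs
      rw [hout (fun h1 => absurd h1.2 hs.not_ge)]; simp
    · rw [h.ends_ray, Finset.sum_singleton, hu]
      filter_upwards [ht 0, hr] with s hs hr
      by_cases h0 : 0 < det (latticeVec u) ξ / det v (latticeVec u)
      · rw [if_pos h0, hin (by rw [interior_Ici]; exact hs) (hr.2 h0), hn]
      · rw [if_neg h0, hout (fun _ => fun h1 => h0 (hr.1 h1))]; simp
    · have hu' : coneRot ξ v (-u) = 0 := by
        rw [coneRot, if_neg]
        rw [latticeVec_neg, det_neg_left]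
        rintro ⟨-, h1⟩
        linarith
      rw [h.ends_line, Finset.sum_pair h.prim.ne_neg, hu', add_zero, hu]
      filter_upwards [hr] with s hr
      by_cases h0 : 0 < det (latticeVec u) ξ / det v (latticeVec u)
      · rw [if_pos h0, hin (by rw [interior_univ]; trivial) (hr.2 h0), hn]
      · rw [if_neg h0, hout (fun _ => fun h1 => h0 (hr.1 h1))]; simp
  · have ha := div_neg_of_neg_of_pos hA hd'
    have hn : normalToward v u = -rot u := by rw [normalToward, if_neg (by linarith)]
    have ht := eventually_mul_add_lt ha (-(det v P / det v (latticeVec u)))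
    simp_rw [← det_smul_sub_div] at ht
    have hu : coneRot ξ v u = 0 := by
      rw [coneRot, if_neg]
      rintro ⟨-, h1⟩
      linarith
    rcases h.dom with ⟨l, hl, rfl⟩ | rfl | rfl
    · rw [h.ends_segment]
      filter_upwards [ht 0] with s hs
      rw [hout (fun h1 => absurd h1.1 hs.not_ge)]; simp
    · rw [h.ends_ray, Finset.sum_singleton, hu]
      filter_upwards [ht 0] with s hs
      rw [hout (fun h1 => absurd (Set.mem_Ici.1 h1) hs.not_ge)]; simp
    · have hu' : coneRot ξ v (-u) =
          if 0 < det (latticeVec u) ξ / det v (latticeVec u) then -rot u else 0 := by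
        rw [coneRot, map_neg]
        congr 1
        rw [latticeVec_neg, det_neg_left, det_neg_right, e1, e2, div_pos_iff]
        apply propext
        constructor
        · rintro ⟨h1, -⟩; exact Or.inl ⟨by linarith, hd'⟩
        · rintro (h1 | h1) <;> constructor <;> linarith
      rw [h.ends_line, Finset.sum_pair h.prim.ne_neg, hu, zero_add, hu']
      filter_upwards [hr] with s hr
      by_cases h0 : 0 < det (latticeVec u) ξ / det v (latticeVec u)
      · rw [if_pos h0, hin (by rw [interior_univ]; trivial) (hr.2 h0), hn]
      · rw [if_neg h0, hout (fun _ => fun h1 => h0 (hr.1 h1))]; simp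

/-- The position of the crossing on the ray decreases with slope `-1` in `s`, so the edge ends up
behind the point. -/
lemma eventually_shadowTerm_far_self (h : IsEdgeParam E P u I) (hξ : IsGeneric ξ) :
    ∀ᶠ s : ℝ in atTop, shadowTerm ξ E (s • ξ) = 0 := by
  have hd := hξ.det_ne_zero h.prim
  have h1 : det (latticeVec u) ξ / det ξ (latticeVec u) < 0 := by
    rw [det_swap, neg_div, div_self hd]; norm_num
  filter_upwards [eventually_mul_add_lt h1 (-(det (latticeVec u) P / det ξ (latticeVec u))) 0]
    with s hs
  rw [← det_smul_sub_div] at hs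
  rw [shadowTerm, if_neg]
  intro h2
  exact hs.not_gt ((h.mem_shadow_iff hξ).1 h2).2.1

end IsEdgeParam

variable (L : TropicalCurve) {ξ v : Plane}

lemma eventually_smul_notMem_carrier (hξ : IsGeneric ξ) :
    ∀ᶠ s : ℝ in atTop, s • ξ ∉ L.carrier := by
  have : ∀ᶠ s : ℝ in atTop, ∀ E ∈ L.edges, s • ξ ∉ E := by
    rw [Filter.eventually_all_finset]
    intro E hE
    obtain ⟨P, u, I, h⟩ := L.exists_param hE
    filter_upwards [eventually_ne_atTop (det (latticeVec u) (0 - P) / det ξ (latticeVec u))]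
      with s hs hsE
    exact hs ((h.add_smul_mem_iff hξ (x := 0) (r := s)).1 (by simpa using hsE)).2
  filter_upwards [this] with s hs
  rintro ⟨E, hE, hsE⟩
  exact hs E hE hsE

lemma eventually_potential_far (hv : IsGeneric v) (hξ : IsGeneric ξ) (hξv : 0 < det ξ v) :
    ∀ᶠ s : ℝ in atTop,
      L.potential v (s • ξ) = -L.endWeight.sum fun u d => d • coneRot ξ v u := by
  have : ∀ᶠ s : ℝ in atTop, ∀ E ∈ L.edges,
      shadowTerm v E (s • ξ) = -∑ u ∈ ends E, coneRot ξ v u := by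
    rw [Filter.eventually_all_finset]
    intro E hE
    obtain ⟨P, u, I, h⟩ := L.exists_param hE
    exact h.eventually_shadowTerm_far hv hξ hξv
  filter_upwards [this] with s hs
  rw [endWeight_sum, potential, ← Finset.sum_neg_distrib]
  refine Finset.sum_congr rfl fun E hE => ?_
  rw [hs E hE, smul_neg, Finset.smul_sum]

lemma eventually_potential_far_self (hξ : IsGeneric ξ) :
    ∀ᶠ s : ℝ in atTop, L.potential ξ (s • ξ) = 0 := by
  have : ∀ᶠ s : ℝ in atTop, ∀ E ∈ L.edges, shadowTerm ξ E (s • ξ) = 0 := by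
    rw [Filter.eventually_all_finset]
    intro E hE
    obtain ⟨P, u, I, h⟩ := L.exists_param hE
    exact h.eventually_shadowTerm_far_self hξ
  filter_upwards [this] with s hs
  exact Finset.sum_eq_zero fun E hE => by rw [hs E hE, smul_zero]

/-- Every term is zero or a nonnegative multiple of the negative of a normal that points to the side
of `ξ`. -/
lemma dot_potential_nonpos (hξ : IsGeneric ξ) (x : Plane) :
    dot (latticeVec (L.potential ξ x)) ξ ≤ 0 := by
  unfold potential
  refine Finset.sum_induction _ (fun z => dot (latticeVec z) ξ ≤ 0) ?_ ?_ ?_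
  · intro a b ha hb
    rw [latticeVec_add, dot_add_left]; linarith
  · simp [dot]
  · intro E hE
    rw [latticeVec_nsmul, dot_smul_left]
    apply mul_nonpos_of_nonneg_of_nonpos (Nat.cast_nonneg _)
    unfold shadowTerm
    split_ifs
    · obtain ⟨P, I, h⟩ := exists_param_direction (L.isRationalEdge_of_mem hE)
      rw [latticeVec_neg, dot_neg_left]
      linarith [dot_normalToward_pos (hξ.det_ne_zero' h.prim)]
    · simp [dot]

/-! ### Extremal lattice points of the Newton polygon -/

/-- The lattice point `c` of `Δ` is extremal in the direction `ξ`. -/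
def IsTop (Δ : Set Plane) (ξ : Plane) (c : ℤ × ℤ) : Prop :=
  latticeVec c ∈ Δ ∧ ∀ y ∈ Δ, dot y ξ ≤ dot (latticeVec c) ξ

lemma IsTop.unique {Δ : Set Plane} {c d : ℤ × ℤ} (hξ : IsGeneric ξ) (hc : IsTop Δ ξ c)
    (hd : IsTop Δ ξ d) : c = d :=
  hξ.eq_of_dot_eq (le_antisymm (hd.2 _ hc.1) (hc.2 _ hd.1))

lemma isLinearMap_dot (ξ : Plane) : IsLinearMap ℝ fun y => dot y ξ where
  map_add _ _ := dot_add_left _ _ _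
  map_smul _ _ := dot_smul_left _ _ _

variable {L}

lemma isTop_convexHull {ι : Type*} {w : ι → ℤ × ℤ} {i : ι}
    (h : ∀ j, dot (latticeVec (w j)) ξ ≤ dot (latticeVec (w i)) ξ) :
    IsTop (convexHull ℝ (Set.range fun i => latticeVec (w i))) ξ (w i) := by
  refine ⟨subset_convexHull _ _ ⟨i, rfl⟩, ?_⟩
  refine convexHull_min ?_ (convex_halfSpace_le (isLinearMap_dot ξ) _)
  rintro _ ⟨j, rfl⟩
  exact h j

/-- The potential vanishes far out along `ξ` and has nonpositive product with `ξ` everywhere, so the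
region at infinity in this direction carries the extremal point. -/
lemma IsNewtonComplex.isTop {w : L.Region → ℤ × ℤ} (hξ : IsGeneric ξ) {c : ℤ × ℤ}
    (hc : ∀ (x : Plane) (hx : x ∉ L.carrier), w (L.regionOf hx) = L.potential ξ x + c) :
    IsTop (convexHull ℝ (Set.range fun i => latticeVec (w i))) ξ c := by
  obtain ⟨s, h1, h2⟩ :=
    ((L.eventually_smul_notMem_carrier hξ).and (L.eventually_potential_far_self hξ)).exists
  have h3 := hc _ h1
  rw [h2, zero_add] at h3
  rw [← h3]
  apply isTop_convexHull
  intro j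
  obtain ⟨x, hx, rfl⟩ := exists_regionOf_eq j
  rw [hc x hx, h3, latticeVec_add, dot_add_left]
  linarith [L.dot_potential_nonpos hξ x]

lemma IsNewtonPolygon.exists_isTop {Δ : Set Plane} (hΔ : L.IsNewtonPolygon Δ)
    (hξ : IsGeneric ξ) : ∃ c, IsTop Δ ξ c := by
  obtain ⟨w, hw, rfl⟩ := hΔ
  obtain ⟨c, hc⟩ := hw.exists_eq_potential_add hξ
  exact ⟨c, IsNewtonComplex.isTop hξ hc⟩

/-- The boundary of the Newton polygon is determined by the asymptotic directions. -/
lemma IsNewtonPolygon.isTop_sub_isTop {Δ : Set Plane} (hΔ : L.IsNewtonPolygon Δ)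
    (hξ : IsGeneric ξ) (hv : IsGeneric v) (hξv : 0 < det ξ v) {c d : ℤ × ℤ} (hc : IsTop Δ ξ c)
    (hd : IsTop Δ v d) : c - d = -L.endWeight.sum fun u d => d • coneRot ξ v u := by
  obtain ⟨w, hw, rfl⟩ := hΔ
  obtain ⟨c', hc'⟩ := hw.exists_eq_potential_add hξ
  obtain ⟨d', hd'⟩ := hw.exists_eq_potential_add hv
  rw [hc.unique hξ (IsNewtonComplex.isTop hξ hc'), hd.unique hv (IsNewtonComplex.isTop hv hd')]
  -- The same far point is evaluated with both potentials; the constants of translation are the two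
  -- extremal points.
  obtain ⟨s, h1, h2, h3⟩ := ((L.eventually_smul_notMem_carrier hξ).and
    ((L.eventually_potential_far_self hξ).and (L.eventually_potential_far hv hξ hξv))).exists
  have h4 := hc' _ h1
  rw [hd' _ h1, h2, h3, zero_add] at h4
  rw [← h4]; abel

lemma exists_isNewtonPolygon (L : TropicalCurve) : ∃ Δ, L.IsNewtonPolygon Δ := by
  obtain ⟨w, hw, -⟩ := exists_isNewtonComplex_of_potential (L := L) isGeneric_one_sqrt_two
  exact ⟨_, w, hw, rfl⟩

end TropicalCurve

namespace TropicalCurve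

/-! ### Newton polygon and asymptotic directions determine each other -/

lemma exists_dot_eq (f : StrongDual ℝ Plane) : ∃ η : Plane, ∀ y, f y = dot y η := by
  refine ⟨(f (1, 0), f (0, 1)), fun y => ?_⟩
  have : y = y.1 • ((1, 0) : Plane) + y.2 • ((0, 1) : Plane) := by ext <;> simp
  conv_lhs => rw [this]
  rw [map_add, map_smul, map_smul]
  rfl

/-- A polygon contains every set with the same extremal points in generic directions. -/
lemma subset_convexHull_of_isTop {Δ S : Set Plane} (hS : S.Finite)
    (h : ∀ ξ, IsGeneric ξ → det ξ (1, √2) ≠ 0 → ∃ c, IsTop Δ ξ c ∧ IsTop (convexHull ℝ S) ξ c) :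
    Δ ⊆ convexHull ℝ S := by
  intro z hz
  by_contra hzS
  -- A functional separating `z` from the finite set stays separating under a small perturbation,
  -- hence may be taken generic and not parallel to `(1, √2)`. In that direction the common extremal
  -- point contradicts `z ∈ Δ`.
  obtain ⟨f, r, h1, h2⟩ := geometric_hahn_banach_closed_point (convex_convexHull ℝ S)
    (hS.isCompact_convexHull ℝ).isClosed hzS
  obtain ⟨η, hη⟩ := exists_dot_eq f
  have hev : ∀ᶠ ε in 𝓝[>] (0 : ℝ), ∀ a ∈ S,
      dot a (η + ε • ((-1, √2) : Plane)) < dot z (η + ε • ((-1, √2) : Plane)) := by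
    rw [Set.Finite.eventually_all hS]
    intro a ha
    have h3 : dot a η < dot z η := by
      rw [← hη, ← hη]
      exact (h1 a (subset_convexHull ℝ S ha)).trans h2
    have hc : ∀ b : Plane, Tendsto (fun ε : ℝ => dot b (η + ε • ((-1, √2) : Plane))) (𝓝[>] 0)
        (𝓝 (dot b η)) := by
      intro b
      have : Continuous fun ε : ℝ => dot b (η + ε • ((-1, √2) : Plane)) := by
        unfold dot; fun_prop
      simpa using (this.tendsto 0).mono_left nhdsWithin_le_nhds
    exact (hc a).eventually_lt (hc z) h3
  have hd : det (-1, √2) (1, √2) ≠ 0 := by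
    have : (0 : ℝ) < √2 := by positivity
    simp only [det]; linarith
  obtain ⟨ε, -, h3, h4⟩ := exists_pos_of_eventually_of_countable hev
    ((isGeneric_neg_one_sqrt_two.countable_not_isGeneric η).union
      (countable_setOf_add_mul_eq_zero (det η (1, √2)) hd))
  rw [Set.mem_union, not_or] at h4
  obtain ⟨c, hc1, hc2⟩ := h (η + ε • ((-1, √2) : Plane)) (not_not.1 h4.1) (by
    rw [det_add_left, det_smul_left]; exact h4.2)
  have h5 : convexHull ℝ S ⊆ {y | dot y (η + ε • ((-1, √2) : Plane)) <
      dot z (η + ε • ((-1, √2) : Plane))} :=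
    convexHull_min h3 (convex_halfSpace_lt (isLinearMap_dot _) _)
  exact lt_irrefl _ ((h5 hc2.1).trans_le (hc1.2 z hz))

lemma exists_normalized_newtonPolygon (L : TropicalCurve) {v : Plane} (hv : IsGeneric v) :
    ∃ w : L.Region → ℤ × ℤ, L.IsNewtonComplex w ∧
      IsTop (convexHull ℝ (Set.range fun i => latticeVec (w i))) v 0 := by
  obtain ⟨w, hw, h⟩ := exists_isNewtonComplex_of_potential (L := L) hv
  exact ⟨w, hw, IsNewtonComplex.isTop hv (by simpa using h)⟩

/-- The end weights fix the difference of the extremal points for `v` and `ξ`, so agreement at `v`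
forces agreement at `ξ`. The orientation of the pair decides in which order the cone formula
applies. -/
lemma IsNewtonPolygon.eq_of_isTop {L L' : TropicalCurve} (h : L.endWeight = L'.endWeight)
    {Δ Δ' : Set Plane} (hΔ : L.IsNewtonPolygon Δ) (hΔ' : L'.IsNewtonPolygon Δ') {v ξ : Plane}
    (hv : IsGeneric v) (hξ : IsGeneric ξ) (hξv : det ξ v ≠ 0) {a c c' : ℤ × ℤ}
    (ha : IsTop Δ v a) (ha' : IsTop Δ' v a) (hc : IsTop Δ ξ c) (hc' : IsTop Δ' ξ c') :
    c = c' := by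
  rcases hξv.lt_or_gt with hd | hd
  · have hd' : 0 < det v ξ := by rw [det_swap]; linarith
    have h1 := hΔ.isTop_sub_isTop hv hξ hd' ha hc
    have h2 := hΔ'.isTop_sub_isTop hv hξ hd' ha' hc'
    rw [h, ← h2] at h1
    exact sub_right_injective h1
  · have h1 := hΔ.isTop_sub_isTop hξ hv hd hc ha
    have h2 := hΔ'.isTop_sub_isTop hξ hv hd hc' ha'
    rw [h, ← h2] at h1
    exact sub_left_injective h1

lemma IsNewtonComplex.finite_vertexSet {L : TropicalCurve} {w : L.Region → ℤ × ℤ}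
    (hw : L.IsNewtonComplex w) : (Set.range fun i => latticeVec (w i)).Finite := by
  have := hw.finite_range.image latticeVec
  rwa [← Set.range_comp] at this

/-- Curves with the same asymptotic directions have the same Newton polygon. -/
lemma sameNewtonPolygon_of_endWeight_eq {L L' : TropicalCurve} (h : L.endWeight = L'.endWeight) :
    L.SameNewtonPolygon L' := by
  have hv := isGeneric_one_sqrt_two
  obtain ⟨w, hw, ht⟩ := L.exists_normalized_newtonPolygon hv
  obtain ⟨w', hw', ht'⟩ := L'.exists_normalized_newtonPolygon hv
  have hΔ : L.IsNewtonPolygon _ := ⟨w, hw, rfl⟩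
  have hΔ' : L'.IsNewtonPolygon _ := ⟨w', hw', rfl⟩
  have key : ∀ ξ, IsGeneric ξ → det ξ (1, √2) ≠ 0 →
      ∃ c, IsTop (convexHull ℝ (Set.range fun i => latticeVec (w i))) ξ c ∧
        IsTop (convexHull ℝ (Set.range fun i => latticeVec (w' i))) ξ c := by
    intro ξ hξ hξv
    obtain ⟨c, hc⟩ := hΔ.exists_isTop hξ
    obtain ⟨c', hc'⟩ := hΔ'.exists_isTop hξ
    have := hΔ.eq_of_isTop h hΔ' hv hξ hξv ht ht' hc hc'
    exact ⟨c, hc, this ▸ hc'⟩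
  refine ⟨_, hΔ, w', hw', subset_antisymm ?_ ?_⟩
  · exact subset_convexHull_of_isTop hw'.finite_vertexSet key
  · refine subset_convexHull_of_isTop hw.finite_vertexSet fun ξ hξ hξv => ?_
    obtain ⟨c, h1, h2⟩ := key ξ hξ hξv
    exact ⟨c, h2, h1⟩

/-- Without ends all extremal points coincide and the polygon is a single point, whereas the Newton
complex has a nonzero jump across any edge. -/
lemma endWeight_ne_zero (L : TropicalCurve) : L.endWeight ≠ 0 := by
  intro h0
  have hv := isGeneric_one_sqrt_two
  obtain ⟨w, hw, ht⟩ := L.exists_normalized_newtonPolygon hv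
  have hΔ : L.IsNewtonPolygon _ := ⟨w, hw, rfl⟩
  have hsub : convexHull ℝ (Set.range fun i => latticeVec (w i)) ⊆ convexHull ℝ {0} := by
    refine subset_convexHull_of_isTop (Set.finite_singleton _) fun ξ hξ hξv => ⟨0, ?_, ?_⟩
    · obtain ⟨c, hc⟩ := hΔ.exists_isTop hξ
      suffices c = 0 from this ▸ hc
      rcases hξv.lt_or_gt with hd | hd
      · have h1 := hΔ.isTop_sub_isTop hv hξ (by rw [det_swap]; linarith) ht hc
        rw [h0, Finsupp.sum_zero_index] at h1
        simpa using h1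
      · have h1 := hΔ.isTop_sub_isTop hξ hv hd hc ht
        rw [h0, Finsupp.sum_zero_index] at h1
        simpa using h1
    · simp [IsTop]
  have hw0 : ∀ i, w i = 0 := by
    intro i
    have := hsub (subset_convexHull _ _ ⟨i, rfl⟩)
    rw [convexHull_singleton, Set.mem_singleton_iff] at this
    exact latticeVec_eq_zero.1 this
  obtain ⟨E, hE⟩ := L.nonempty
  obtain ⟨P, u, I, h⟩ := L.exists_param hE
  obtain ⟨t, ht⟩ := h.interior_dom_nonempty
  have hx : P + t • latticeVec u ∉ L.vertices := fun hx =>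
    (h.mem_extremePoints_iff.1 (mem_extremePoints_of_mem_vertices hx hE
      (h.mem (interior_subset ht)))).2 ht
  obtain ⟨i, j, hij, -⟩ := exists_isNormalFromTo hx hE (h.mem (interior_subset ht)) h
  have h1 := hw E hE i j _ hij
  rw [hw0, hw0, sub_zero] at h1
  rcases smul_eq_zero.1 h1.symm with h2 | h2
  · exact Finsupp.mem_support_iff.1 hE h2
  · exact h.prim.rot.ne_zero h2

/-- The three cones cover the plane up to their boundary rays, which contain no nonzero lattice
vector, so `u` lies in exactly one of them. -/
lemma coneRot_add_coneRot_add_coneRot {a b c : Plane} (ha : IsGeneric a) (hb : IsGeneric b)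
    (hc : IsGeneric c) (hab : 0 < det a b) (hbc : 0 < det b c) (hca : 0 < det c a) {u : ℤ × ℤ}
    (hu : u ≠ 0) : coneRot a b u + coneRot b c u + coneRot c a u = rot u := by
  -- A linear relation with positive coefficients among the three determinants: they cannot all have
  -- the same sign.
  have key : det b c * det a (latticeVec u) + det c a * det b (latticeVec u) +
      det a b * det c (latticeVec u) = 0 := by
    simp only [det]; ring
  simp only [coneRot, det_swap (latticeVec u), Left.neg_pos_iff]
  rcases (ha u hu).lt_or_gt with h1 | h1 <;> rcases (hb u hu).lt_or_gt with h2 | h2 <;>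
    rcases (hc u hu).lt_or_gt with h3 | h3
  · nlinarith
  · simp [h1, h2, h3, h1.not_gt, h2.not_gt, h3.not_gt]
  · simp [h1, h2, h3, h1.not_gt, h2.not_gt, h3.not_gt]
  · simp [h1, h2, h3, h1.not_gt, h2.not_gt, h3.not_gt]
  · simp [h1, h2, h3, h1.not_gt, h2.not_gt, h3.not_gt]
  · simp [h1, h2, h3, h1.not_gt, h2.not_gt, h3.not_gt]
  · simp [h1, h2, h3, h1.not_gt, h2.not_gt, h3.not_gt]
  · have := mul_pos hbc h1
    have := mul_pos hca h2
    have := mul_pos hab h3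
    linarith

/-- The asymptotic directions are balanced. -/
lemma endWeight_balanced (L : TropicalCurve) : (L.endWeight.sum fun u d => d • u) = 0 := by
  obtain ⟨Δ, hΔ⟩ := L.exists_isNewtonPolygon
  have ha := isGeneric_one_sqrt_two
  have hb := isGeneric_neg_one_sqrt_two
  have hc := isGeneric_sqrt_two_neg_four
  have h2 : (0 : ℝ) < √2 := by positivity
  have h22 : √2 * √2 = 2 := Real.mul_self_sqrt (by norm_num)
  have hab : 0 < det (1, √2) (-1, √2) := by simp only [det]; linarith
  have hbc : 0 < det (-1, √2) (√2, -4) := by simp only [det]; linarith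
  have hca : 0 < det (√2, -4) (1, √2) := by simp only [det]; linarith
  obtain ⟨A, hA⟩ := hΔ.exists_isTop ha
  obtain ⟨B, hB⟩ := hΔ.exists_isTop hb
  obtain ⟨C, hC⟩ := hΔ.exists_isTop hc
  have e1 := hΔ.isTop_sub_isTop ha hb hab hA hB
  have e2 := hΔ.isTop_sub_isTop hb hc hbc hB hC
  have e3 := hΔ.isTop_sub_isTop hc ha hca hC hA
  -- The three cone sums are the differences around the cycle of extremal points `A`, `B`, `C`, with
  -- total zero.
  have e4 : (L.endWeight.sum fun u d => d • rot u) = 0 := by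
    have : (L.endWeight.sum fun u d => d • rot u) =
        (L.endWeight.sum fun u d => d • coneRot (1, √2) (-1, √2) u) +
        (L.endWeight.sum fun u d => d • coneRot (-1, √2) (√2, -4) u) +
        (L.endWeight.sum fun u d => d • coneRot (√2, -4) (1, √2) u) := by
      unfold Finsupp.sum
      rw [← Finset.sum_add_distrib, ← Finset.sum_add_distrib]
      refine Finset.sum_congr rfl fun u hu => ?_
      dsimp only
      rw [← smul_add, ← smul_add, coneRot_add_coneRot_add_coneRot ha hb hc hab hbc hca
        (L.isPrimitiveVec_of_mem_support hu).ne_zero]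
    rw [this, ← neg_eq_zero, neg_add, neg_add, ← e1, ← e2, ← e3]
    abel
  apply rot_injective
  rw [map_zero, ← e4, Finsupp.sum, map_sum]
  simp only [map_nsmul]
  rfl

/-- A narrow cone around `u` contains no other of finitely many primitive vectors. -/
lemma exists_generic_pair {u : ℤ × ℤ} (hu : IsPrimitiveVec u) (S : Finset (ℤ × ℤ))
    (hS : ∀ u' ∈ S, IsPrimitiveVec u') : ∃ ξ v : Plane, IsGeneric ξ ∧ IsGeneric v ∧ 0 < det ξ v ∧
      coneRot ξ v u = rot u ∧ ∀ u' ∈ S, u' ≠ u → coneRot ξ v u' = 0 := by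
  obtain ⟨η, hη, hd⟩ : ∃ η, IsGeneric η ∧ 0 < det (latticeVec u) η := by
    have h := isGeneric_one_sqrt_two
    rcases (h.det_ne_zero' hu).lt_or_gt with h1 | h1
    · exact ⟨_, h.neg, by rw [det_neg_right]; linarith⟩
    · exact ⟨_, h, h1⟩
  have hev : ∀ᶠ ε in 𝓝[>] (0 : ℝ), ∀ u' ∈ S, u' ≠ u →
      coneRot (latticeVec u + ε • -η) (latticeVec u + ε • η) u' = 0 := by
    rw [Filter.eventually_all_finset]
    intro u' hu'
    by_cases h0 : u' = u
    · simp [h0]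
    simp only [ne_eq, h0, not_false_eq_true, forall_true_left]
    have c1 : Tendsto (fun ε : ℝ => det (latticeVec u + ε • -η) (latticeVec u')) (𝓝[>] 0)
        (𝓝 (det (latticeVec u) (latticeVec u'))) := by
      have : Continuous fun ε : ℝ => det (latticeVec u + ε • -η) (latticeVec u') := by
        unfold det; fun_prop
      simpa using (this.tendsto 0).mono_left nhdsWithin_le_nhds
    have c2 : Tendsto (fun ε : ℝ => det (latticeVec u') (latticeVec u + ε • η)) (𝓝[>] 0)
        (𝓝 (det (latticeVec u') (latticeVec u))) := by
      have : Continuous fun ε : ℝ => det (latticeVec u') (latticeVec u + ε • η) := by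
        unfold det; fun_prop
      simpa using (this.tendsto 0).mono_left nhdsWithin_le_nhds
    -- A vector `u'` not parallel to `u` violates one of the two cone inequalities already in the
    -- limit `ε → 0`. The remaining vector `-u` violates the second one for every `ε > 0`.
    rcases lt_trichotomy (det (latticeVec u) (latticeVec u')) 0 with h1 | h1 | h1
    · filter_upwards [c1.eventually_lt_const h1] with ε hε
      rw [coneRot, if_neg]
      rintro ⟨h2, -⟩
      linarith
    · have h2 := (hu.eq_or_eq_neg (hS u' hu') h1).resolve_left h0
      filter_upwards [self_mem_nhdsWithin] with ε hε
      rw [coneRot, if_neg]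
      rintro ⟨-, h3⟩
      rw [h2, latticeVec_neg, det_neg_left, det_add_right, det_self, det_smul_right] at h3
      have := mul_pos (Set.mem_Ioi.1 hε) hd
      linarith
    · filter_upwards [c2.eventually_lt_const (u := 0) (by rw [det_swap]; linarith)] with ε hε
      rw [coneRot, if_neg]
      rintro ⟨-, h2⟩
      linarith
  obtain ⟨ε, hε, h1, h2⟩ := exists_pos_of_eventually_of_countable hev
    ((hη.countable_not_isGeneric (latticeVec u)).union
      (hη.neg.countable_not_isGeneric (latticeVec u)))
  rw [Set.mem_union, not_or] at h2
  have hpos := mul_pos hε hd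
  refine ⟨_, _, not_not.1 h2.2, not_not.1 h2.1, ?_, ?_, h1⟩
  · simp only [det_add_left, det_add_right, det_smul_left, det_smul_right, det_neg_left, det_self,
      det_swap η (latticeVec u)]
    linarith
  · rw [coneRot, if_pos]
    simp only [det_add_left, det_add_right, det_smul_left, det_smul_right, det_neg_left, det_self,
      det_swap η (latticeVec u)]
    constructor <;> linarith

/-- Curves with the same Newton polygon have the same asymptotic directions. -/
lemma SameNewtonPolygon.endWeight_eq {L L' : TropicalCurve} (h : L.SameNewtonPolygon L') :
    L.endWeight = L'.endWeight := by
  classical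
  obtain ⟨Δ, hΔ, hΔ'⟩ := h
  set S := L.endWeight.support ∪ L'.endWeight.support with hSdef
  have hS : ∀ u ∈ S, IsPrimitiveVec u := by
    intro u hu
    rcases Finset.mem_union.1 hu with h | h
    · exact L.isPrimitiveVec_of_mem_support h
    · exact L'.isPrimitiveVec_of_mem_support h
  ext u
  by_cases huS : u ∈ S
  · obtain ⟨ξ, v, hξ, hv, hξv, h1, h2⟩ := exists_generic_pair (hS u huS) S hS
    obtain ⟨c, hc⟩ := hΔ.exists_isTop hξ
    obtain ⟨d, hd⟩ := hΔ.exists_isTop hv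
    -- The cone isolates `u`, so the cone sum reduces to the weight of this one direction.
    have e : ∀ g : (ℤ × ℤ) →₀ ℕ, g.support ⊆ S →
        (g.sum fun u d => d • coneRot ξ v u) = g u • rot u := by
      intro g hg
      rw [Finsupp.sum_of_support_subset _ hg _ (by simp), Finset.sum_eq_single u, h1]
      · intro u' hu' hne
        rw [h2 u' hu' hne, smul_zero]
      · exact fun h => absurd huS h
    have e1 := hΔ.isTop_sub_isTop hξ hv hξv hc hd
    have e2 := hΔ'.isTop_sub_isTop hξ hv hξv hc hd
    rw [e _ Finset.subset_union_left] at e1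
    rw [e _ Finset.subset_union_right, e1, neg_inj] at e2
    have e3 := congrArg latticeVec e2
    rw [latticeVec_nsmul, latticeVec_nsmul] at e3
    exact Nat.cast_injective (smul_left_injective ℝ (hS u huS).rot.latticeVec_ne_zero e3)
  · rw [hSdef, Finset.mem_union, not_or, Finsupp.notMem_support_iff,
      Finsupp.notMem_support_iff] at huS
    rw [huS.1, huS.2]

end TropicalCurve

namespace TropicalCurve

/-! ### Invariance of the asymptotic directions -/

/-- A line not parallel to the edge meets it at most once; if it is parallel and `u` is not an end,
the edge does not extend to infinity on that side. -/
lemma IsEdgeParam.eventually_notMem {E : Set Plane} {P : Plane} {v : ℤ × ℤ} {I : Set ℝ}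
    (h : IsEdgeParam E P v I) {u : ℤ × ℤ} (hu : IsPrimitiveVec u) (huE : u ∉ endSet E)
    (y : Plane) : ∀ᶠ s : ℝ in atTop, y + s • latticeVec u ∉ E := by
  by_cases hd : det (latticeVec v) (latticeVec u) = 0
  · have hneg := h.prim.eq_or_eq_neg hu hd
    rcases h.dom with ⟨l, hl, rfl⟩ | rfl | rfl
    · exact eventually_notMem_of_isBounded h.isBounded hu y
    · have hne : u = -v := hneg.resolve_left (by rintro rfl; rw [h.endSet_ray] at huE; simp at huE)
      subst hne
      by_cases hex : ∃ s₀ : ℝ, y + s₀ • latticeVec (-v) ∈ E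
      · obtain ⟨s₀, hs₀⟩ := hex
        obtain ⟨t, ht, e⟩ := h.mem_iff.1 hs₀
        filter_upwards [eventually_gt_atTop (s₀ + t)] with s hs hmem
        have e2 : y + s • latticeVec (-v) = P + (t - (s - s₀)) • latticeVec v := by
          have : y + s • latticeVec (-v) =
              y + s₀ • latticeVec (-v) - (s - s₀) • latticeVec v := by
            ext <;> simp <;> ring
          rw [this, ← e]; module
        rw [e2, h.param_mem_iff] at hmem
        have : 0 ≤ t - (s - s₀) := hmem
        linarith
      · push Not at hex
        exact Eventually.of_forall hex
    · rw [h.endSet_line] at huE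
      exact absurd hneg huE
  · by_cases hex : ∃ s₀ : ℝ, y + s₀ • latticeVec u ∈ E
    · obtain ⟨s₀, hs₀⟩ := hex
      filter_upwards [eventually_ne_atTop s₀] with s hs hmem
      have := h.det_sub hmem hs₀
      rw [add_sub_add_left_eq_sub, ← sub_smul, det_smul_right] at this
      exact hs (sub_eq_zero.1 ((mul_eq_zero.1 this).resolve_right hd))
    · push Not at hex
      exact Eventually.of_forall hex

lemma IsEdgeParam.exists_param_of_mem_endSet {E : Set Plane} {P : Plane} {v : ℤ × ℤ} {I : Set ℝ}
    (h : IsEdgeParam E P v I) {u : ℤ × ℤ} (hu : u ∈ endSet E) :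
    ∃ J, IsEdgeParam E P u J ∧ Set.Ici 0 ⊆ J := by
  rcases h.dom with ⟨l, hl, rfl⟩ | rfl | rfl
  · rw [h.endSet_segment] at hu; exact hu.elim
  · rw [h.endSet_ray] at hu
    obtain rfl := Set.mem_singleton_iff.1 hu
    exact ⟨_, h, subset_rfl⟩
  · rw [h.endSet_line] at hu
    rcases hu with rfl | rfl
    · exact ⟨_, h, Set.subset_univ _⟩
    · exact ⟨_, h.reverse_line, Set.subset_univ _⟩

open scoped Classical in
/-- The foot of the perpendicular from the origin to the line through a point of `X` with
direction `u`. -/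
noncomputable def foot (u : ℤ × ℤ) (X : Set Plane) : Plane :=
  if h : X.Nonempty then h.some - (dot h.some (latticeVec u) /
    dot (latticeVec u) (latticeVec u)) • latticeVec u else 0

lemma dot_foot {u : ℤ × ℤ} (hu : IsPrimitiveVec u) (X : Set Plane) :
    dot (foot u X) (latticeVec u) = 0 := by
  have h0 := (dot_self_pos hu.latticeVec_ne_zero).ne'
  unfold foot
  split_ifs
  · rw [dot_sub_left, dot_smul_left, div_mul_cancel₀ _ h0, sub_self]
  · simp [dot]

/-- Far out, an edge with end `u` coincides with the line it spans, and `foot` labels this line by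
its point orthogonal to `u`. -/
lemma IsEdgeParam.eventually_mem_iff {E : Set Plane} {P : Plane} {v : ℤ × ℤ} {I : Set ℝ}
    (h : IsEdgeParam E P v I) {u : ℤ × ℤ} (hu : u ∈ endSet E) {y : Plane}
    (hy : dot y (latticeVec u) = 0) :
    ∀ᶠ s : ℝ in atTop, (y + s • latticeVec u ∈ E ↔ foot u E = y) := by
  obtain ⟨J, hJ, hJI⟩ := h.exists_param_of_mem_endSet hu
  have hu0 := hu.1.latticeVec_ne_zero
  have hne : E.Nonempty := ⟨P, h.base_mem⟩
  have hfoot : ∃ a : ℝ, foot u E = P + a • latticeVec u := by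
    obtain ⟨t, -, e⟩ := hJ.mem_iff.1 hne.some_mem
    rw [foot, dif_pos hne]
    refine ⟨t - dot hne.some (latticeVec u) / dot (latticeVec u) (latticeVec u), ?_⟩
    rw [sub_smul, ← add_sub_assoc, e]
  obtain ⟨a, ha⟩ := hfoot
  by_cases hf : foot u E = y
  · filter_upwards [eventually_ge_atTop (-a)] with s hs
    refine iff_of_true ?_ hf
    rw [← hf, ha, add_assoc, ← add_smul]
    exact hJ.mem (hJI (by rw [Set.mem_Ici]; linarith))
  · refine Eventually.of_forall fun s => iff_of_false (fun hmem => hf ?_) hf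
    obtain ⟨t, -, e⟩ := hJ.mem_iff.1 hmem
    have e2 : foot u E = y + (s - t + a) • latticeVec u := by
      rw [ha, add_smul, sub_smul, ← add_assoc, ← add_sub_assoc, ← e]; abel
    have h3 := dot_foot hu.1 E
    rw [e2, dot_add_left, hy, zero_add, dot_smul_left] at h3
    rw [e2, (mul_eq_zero.1 h3).resolve_right (dot_self_pos hu0).ne', zero_smul, add_zero]

/-- The bounded alternative is needed because a contracted edge has a one-point image, which is not
a rational edge. -/
lemma eventually_mem_iff {X : Set Plane} (hX : Bornology.IsBounded X ∨ IsRationalEdge X)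
    {u : ℤ × ℤ} (hu : IsPrimitiveVec u) {y : Plane} (hy : dot y (latticeVec u) = 0) :
    ∀ᶠ s : ℝ in atTop, (y + s • latticeVec u ∈ X ↔ u ∈ ends X ∧ foot u X = y) := by
  rcases hX with hX | hX
  · have h0 := endSet_eq_empty_of_isBounded hX
    have : u ∉ ends X := by
      rw [mem_ends_iff (by simp [h0]), h0]; exact Set.notMem_empty u
    filter_upwards [eventually_notMem_of_isBounded hX hu y] with s hs
    exact iff_of_false hs fun h => this h.1
  · obtain ⟨P, v, I, h⟩ := hX.exists_param
    rw [mem_ends hX]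
    by_cases huX : u ∈ endSet X
    · filter_upwards [h.eventually_mem_iff huX hy] with s hs
      simp [hs, huX]
    · filter_upwards [h.eventually_notMem hu huX y] with s hs
      exact iff_of_false hs fun h => huX h.1

open scoped Classical in
/-- The weights of the ends of a weighted family of edges are determined by the total weights at all
but finitely many points. -/
lemma sum_ends_eq_of_finite {ι κ : Type*} {A : Finset ι} {B : Finset κ} {X : ι → Set Plane}
    {Y : κ → Set Plane} (hX : ∀ i ∈ A, Bornology.IsBounded (X i) ∨ IsRationalEdge (X i))
    (hY : ∀ j ∈ B, Bornology.IsBounded (Y j) ∨ IsRationalEdge (Y j)) (k : ι → ℕ) (l : κ → ℕ)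
    (hfin : {x : Plane | ∑ i ∈ A with x ∈ X i, k i ≠ ∑ j ∈ B with x ∈ Y j, l j}.Finite)
    {u : ℤ × ℤ} (hu : IsPrimitiveVec u) :
    ∑ i ∈ A with u ∈ ends (X i), k i = ∑ j ∈ B with u ∈ ends (Y j), l j := by
  have key : ∀ y : Plane, dot y (latticeVec u) = 0 →
      ∑ i ∈ A with u ∈ ends (X i) ∧ foot u (X i) = y, k i =
        ∑ j ∈ B with u ∈ ends (Y j) ∧ foot u (Y j) = y, l j := by
    intro y hy
    have h1 : ∀ᶠ s : ℝ in atTop, ∀ i ∈ A,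
        (y + s • latticeVec u ∈ X i ↔ u ∈ ends (X i) ∧ foot u (X i) = y) := by
      rw [Filter.eventually_all_finset]
      exact fun i hi => eventually_mem_iff (hX i hi) hu hy
    have h2 : ∀ᶠ s : ℝ in atTop, ∀ j ∈ B,
        (y + s • latticeVec u ∈ Y j ↔ u ∈ ends (Y j) ∧ foot u (Y j) = y) := by
      rw [Filter.eventually_all_finset]
      exact fun i hi => eventually_mem_iff (hY i hi) hu hy
    -- A point far out on the line through `y` avoids the finite exceptional set and sees exactly
    -- the ends lying on that line.
    obtain ⟨s, h3, h4, h5⟩ :=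
      (h1.and (h2.and (eventually_notMem_of_isBounded hfin.isBounded hu y))).exists
    rw [← Finset.filter_congr h3, ← Finset.filter_congr h4]
    simpa using h5
  -- The ends in the direction `u` are grouped by the parallel lines that carry them.
  set T : Finset Plane := A.image (fun i => foot u (X i)) ∪ B.image (fun j => foot u (Y j))
  rw [← Finset.sum_fiberwise_of_maps_to (t := T) (g := fun i => foot u (X i)),
    ← Finset.sum_fiberwise_of_maps_to (t := T) (g := fun j => foot u (Y j))]
  · refine Finset.sum_congr rfl fun y hy => ?_
    rw [Finset.filter_filter, Finset.filter_filter]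
    apply key
    rcases Finset.mem_union.1 hy with h | h
    · obtain ⟨i, -, rfl⟩ := Finset.mem_image.1 h
      exact dot_foot hu _
    · obtain ⟨i, -, rfl⟩ := Finset.mem_image.1 h
      exact dot_foot hu _
  · intro j hj
    exact Finset.mem_union_right _ (Finset.mem_image_of_mem _ (Finset.mem_filter.1 hj).1)
  · intro i hi
    exact Finset.mem_union_left _ (Finset.mem_image_of_mem _ (Finset.mem_filter.1 hi).1)

open scoped Classical in
lemma endWeight_apply (L : TropicalCurve) (u : ℤ × ℤ) :
    L.endWeight u = ∑ E ∈ L.edges with u ∈ ends E, L.wt E := by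
  rw [endWeight, Finsupp.finsetSum_apply, Finset.sum_filter]
  refine Finset.sum_congr rfl fun E _ => ?_
  rw [Finsupp.finsetSum_apply]
  simp only [Finsupp.single_apply, Finset.sum_ite_eq']

/-! ### Images of edges under the maps of a closed cone -/

lemma IsEdgeParam.image_add {E : Set Plane} {P : Plane} {u : ℤ × ℤ} {I : Set ℝ}
    (h : IsEdgeParam E P u I) (c : Plane) :
    IsEdgeParam ((fun x => x + c) '' E) (P + c) u I := by
  refine ⟨h.prim, h.dom, ?_⟩
  rw [h.eq, Set.image_image]
  refine Set.image_congr fun t _ => ?_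
  abel

variable {L : TropicalCurve}

lemma mem_carrier {E : Set Plane} (hE : E ∈ L.edges) {x : Plane} (hx : x ∈ E) : x ∈ L.carrier :=
  ⟨E, hE, hx⟩

lemma edgeImage_eq_image_add {φ : ↥L.carrier → Plane} (hφ : φ ∈ L.closedCone) {E : Set Plane}
    (hE : E ∈ L.edges) (hb : ¬ Bornology.IsBounded E) :
    ∃ c : Plane, L.edgeImage φ E = (fun x => x + c) '' E := by
  obtain ⟨a, -, ha, h⟩ := hφ E hE
  obtain ⟨P, u, I, hP⟩ := L.exists_param hE
  rw [ha hb] at h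
  refine ⟨φ ⟨P, mem_carrier hE hP.base_mem⟩ - P, ?_⟩
  have key : ∀ x (hx : x ∈ E), φ ⟨x, mem_carrier hE hx⟩ =
      x + (φ ⟨P, mem_carrier hE hP.base_mem⟩ - P) := by
    intro x hx
    have := h ⟨x, mem_carrier hE hx⟩ ⟨P, mem_carrier hE hP.base_mem⟩ hx hP.base_mem
    rw [one_smul, sub_eq_iff_eq_add] at this
    rw [this]; dsimp only; abel
  ext y
  constructor
  · rintro ⟨x, hx, rfl⟩
    exact ⟨x, hx, (key x hx).symm⟩
  · rintro ⟨x, hx, rfl⟩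
    exact ⟨⟨x, mem_carrier hE hx⟩, hx, key x hx⟩

lemma isBounded_edgeImage {φ : ↥L.carrier → Plane} (hφ : φ ∈ L.closedCone) {E : Set Plane}
    (hE : E ∈ L.edges) (hb : Bornology.IsBounded E) : Bornology.IsBounded (L.edgeImage φ E) := by
  obtain ⟨a, -, -, h⟩ := hφ E hE
  obtain ⟨P, u, I, hP⟩ := L.exists_param hE
  set Q : ↥L.carrier := ⟨P, mem_carrier hE hP.base_mem⟩
  obtain ⟨C, hC⟩ := hb.exists_norm_le
  rw [isBounded_iff_forall_norm_le]
  refine ⟨‖φ Q‖ + |a| * (C + ‖P‖), ?_⟩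
  rintro _ ⟨x, hx, rfl⟩
  have e := h x Q hx hP.base_mem
  rw [sub_eq_iff_eq_add] at e
  rw [e]
  calc ‖a • ((x : Plane) - Q) + φ Q‖ ≤ ‖a • ((x : Plane) - Q)‖ + ‖φ Q‖ := norm_add_le _ _
    _ ≤ |a| * (C + ‖P‖) + ‖φ Q‖ := by
      rw [norm_smul, Real.norm_eq_abs]
      gcongr
      exact (norm_sub_le _ _).trans (add_le_add (hC _ hx) le_rfl)
    _ = _ := add_comm _ _

/-- Bounded edges have bounded images, and unbounded ones are only translated. -/
lemma ends_edgeImage {φ : ↥L.carrier → Plane} (hφ : φ ∈ L.closedCone) {E : Set Plane}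
    (hE : E ∈ L.edges) : ends (L.edgeImage φ E) = ends E := by
  ext u
  by_cases hb : Bornology.IsBounded E
  · have h1 := endSet_eq_empty_of_isBounded hb
    have h2 := endSet_eq_empty_of_isBounded (isBounded_edgeImage hφ hE hb)
    rw [mem_ends_iff (by simp [h2]), mem_ends_iff (by simp [h1]), h1, h2]
  · obtain ⟨c, hc⟩ := edgeImage_eq_image_add hφ hE hb
    have h2 := endSet_image_add E c
    have h1 := endSet_finite (L.isRationalEdge_of_mem hE)
    rw [hc, mem_ends_iff (by rwa [h2]), mem_ends_iff h1, h2]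

lemma isBounded_or_isRationalEdge_edgeImage {φ : ↥L.carrier → Plane} (hφ : φ ∈ L.closedCone)
    {E : Set Plane} (hE : E ∈ L.edges) :
    Bornology.IsBounded (L.edgeImage φ E) ∨ IsRationalEdge (L.edgeImage φ E) := by
  by_cases hb : Bornology.IsBounded E
  · exact Or.inl (isBounded_edgeImage hφ hE hb)
  · obtain ⟨c, hc⟩ := edgeImage_eq_image_add hφ hE hb
    obtain ⟨P, u, I, hP⟩ := L.exists_param hE
    right
    rw [hc]
    exact (hP.image_add c).isRationalEdge

/-- All the curves parametrized by a cone have the same asymptotic directions. -/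
lemma Cell.endWeight_eq (x : L.Cell) : x.curve.endWeight = L.endWeight := by
  classical
  obtain ⟨⟨φ, L'⟩, hφ, hfin⟩ := x
  change L'.endWeight = L.endWeight
  ext u
  by_cases hu : IsPrimitiveVec u
  · rw [endWeight_apply, endWeight_apply]
    have := sum_ends_eq_of_finite (A := L'.edges) (B := L.edges) (X := fun E => E)
      (Y := L.edgeImage φ) (fun E hE => Or.inr (L'.isRationalEdge_of_mem hE))
      (fun E hE => isBounded_or_isRationalEdge_edgeImage hφ hE) L'.wt L.wt
      (by unfold IsImage at hfin; convert hfin) hu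
    rw [this]
    refine Finset.sum_congr (Finset.filter_congr fun E hE => ?_) fun _ _ => rfl
    rw [ends_edgeImage hφ hE]
  · rw [Finsupp.notMem_support_iff.1 (mt L'.isPrimitiveVec_of_mem_support hu),
      Finsupp.notMem_support_iff.1 (mt L.isPrimitiveVec_of_mem_support hu)]

/-! ### Level sets of the end weights in the glued topology -/

lemma isOpen_iff {S : Set TropicalCurve} :
    IsOpen S ↔ ∀ L : TropicalCurve, IsOpen (Cell.curve (L := L) ⁻¹' S) := by
  rw [isOpen_iSup_iff]
  exact forall_congr' fun L => isOpen_coinduced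

/-- The end weights are constant on each cell, so the preimage there is everything or empty. An
arbitrary `p` covers a level set and its complement at once. -/
lemma isOpen_setOf_endWeight (p : ((ℤ × ℤ) →₀ ℕ) → Prop) :
    IsOpen {L : TropicalCurve | p L.endWeight} := by
  rw [isOpen_iff]
  intro L
  have : Cell.curve (L := L) ⁻¹' {L : TropicalCurve | p L.endWeight} = {_x | p L.endWeight} := by
    ext x
    simp only [Set.mem_preimage, Set.mem_ofPred_eq, x.endWeight_eq]
  rw [this]
  exact isOpen_const

lemma endWeight_eq_of_connectedComponent_eq {L L' : TropicalCurve}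
    (h : connectedComponent L = connectedComponent L') : L'.endWeight = L.endWeight := by
  have hclopen : IsClopen {M : TropicalCurve | M.endWeight = L.endWeight} :=
    ⟨⟨isOpen_setOf_endWeight fun g => ¬ g = L.endWeight⟩,
      isOpen_setOf_endWeight fun g => g = L.endWeight⟩
  exact hclopen.connectedComponent_subset rfl (h ▸ mem_connectedComponent)

end TropicalCurve

namespace TropicalCurve

/-! ### Fans -/

/-- The ray from the origin in the direction `u`. -/
def ray (u : ℤ × ℤ) : Set Plane := (fun t : ℝ => (0 : Plane) + t • latticeVec u) '' Set.Ici 0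

/-- The line through the origin in the direction `u`. -/
def line (u : ℤ × ℤ) : Set Plane := (fun t : ℝ => (0 : Plane) + t • latticeVec u) '' Set.univ

lemma isEdgeParam_ray {u : ℤ × ℤ} (hu : IsPrimitiveVec u) :
    IsEdgeParam (ray u) 0 u (Set.Ici 0) := ⟨hu, Or.inr (Or.inl rfl), rfl⟩

lemma isEdgeParam_line {u : ℤ × ℤ} (hu : IsPrimitiveVec u) :
    IsEdgeParam (line u) 0 u Set.univ := ⟨hu, Or.inr (Or.inr rfl), rfl⟩

lemma extremePoints_ray {u : ℤ × ℤ} (hu : IsPrimitiveVec u) : (ray u).extremePoints ℝ = {0} := by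
  have h := isEdgeParam_ray hu
  ext x
  rw [Set.mem_singleton_iff]
  constructor
  · intro hx
    obtain ⟨t, ht, rfl⟩ := h.mem_iff.1 hx.1
    have := h.mem_extremePoints_iff.1 hx
    rw [interior_Ici, Set.Ici_sdiff_Ioi_same] at this
    rw [Set.mem_singleton_iff.1 this]; simp
  · rintro rfl
    have := h.mem_extremePoints_iff (t := 0)
    rw [zero_smul, add_zero, interior_Ici, Set.Ici_sdiff_Ioi_same] at this
    exact this.2 rfl

lemma eq_of_mem_ray_of_mem_ray {u v : ℤ × ℤ} (hu : IsPrimitiveVec u) (hv : IsPrimitiveVec v)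
    {x : Plane} (hx : x ≠ 0) (hxu : x ∈ ray u) (hxv : x ∈ ray v) : u = v := by
  obtain ⟨s, hs, rfl⟩ := hxu
  obtain ⟨t, ht, e⟩ := hxv
  simp only [zero_add] at e hx
  have hs : 0 ≤ s := hs
  have ht : 0 ≤ t := ht
  have hs' : s ≠ 0 := by rintro rfl; simp at hx
  have ht' : t ≠ 0 := by rintro rfl; rw [zero_smul] at e; exact hx e.symm
  exact hu.eq_of_smul hv (hs.lt_of_ne' hs') (ht.lt_of_ne' ht') e.symm

lemma mem_line_iff {u : ℤ × ℤ} {x : Plane} : x ∈ line u ↔ x ∈ ray u ∨ x ∈ ray (-u) := by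
  constructor
  · rintro ⟨t, -, rfl⟩
    rcases le_total 0 t with h | h
    · exact Or.inl ⟨t, h, rfl⟩
    · exact Or.inr ⟨-t, by rw [Set.mem_Ici]; linarith, by simp⟩
  · rintro (⟨t, -, rfl⟩ | ⟨t, -, rfl⟩)
    · exact ⟨t, trivial, rfl⟩
    · exact ⟨-t, trivial, by simp⟩

lemma injOn_ray {S : Set (ℤ × ℤ)} (hS : ∀ u ∈ S, IsPrimitiveVec u) : Set.InjOn ray S := by
  intro u hu v hv h
  have h1 := (isEdgeParam_ray (hS u hu)).endSet_ray
  rw [h, (isEdgeParam_ray (hS v hv)).endSet_ray] at h1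
  exact (Set.singleton_injective h1).symm

/-- The fan with at least three rays of given weights. -/
noncomputable def fan (D : (ℤ × ℤ) →₀ ℕ) (hprim : ∀ u ∈ D.support, IsPrimitiveVec u)
    (hbal : (D.sum fun u d => d • u) = 0) (hcard : 3 ≤ D.support.card) : TropicalCurve := by
  classical
  have hinj : Set.InjOn ray (D.support : Set (ℤ × ℤ)) := injOn_ray hprim
  have hsupp : (D.mapDomain ray).support = D.support.image ray :=
    Finsupp.mapDomain_support_of_injOn D hinj
  -- The origin is the only vertex and lies on every ray, so the conditions at the vertex become
  -- `hbal` and `hcard`.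
  have hvert : ∀ E₀ ∈ D.support.image ray, ∀ V ∈ E₀.extremePoints ℝ,
      V = 0 ∧ (D.support.image ray).filter (fun E => V ∈ E) = D.support.image ray := by
    intro E₀ hE₀ V hV
    obtain ⟨u, hu, rfl⟩ := Finset.mem_image.1 hE₀
    rw [extremePoints_ray (hprim u hu)] at hV
    obtain rfl := Set.mem_singleton_iff.1 hV
    refine ⟨rfl, Finset.filter_true_of_mem fun E hE => ?_⟩
    obtain ⟨v, hv, rfl⟩ := Finset.mem_image.1 hE
    exact (isEdgeParam_ray (hprim v hv)).base_mem
  exact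
  { wt := D.mapDomain ray
    nonempty := by
      rw [hsupp]
      exact (Finset.card_pos.1 (by omega)).image ray
    isEdge := by
      rw [hsupp]
      intro E hE
      obtain ⟨u, hu, rfl⟩ := Finset.mem_image.1 hE
      exact (isEdgeParam_ray (hprim u hu)).isRationalEdge
    inter_subset := by
      rw [hsupp]
      rintro E hE F hF hne x ⟨hxE, hxF⟩
      obtain ⟨u, hu, rfl⟩ := Finset.mem_image.1 hE
      obtain ⟨v, hv, rfl⟩ := Finset.mem_image.1 hF
      rw [extremePoints_ray (hprim u hu), extremePoints_ray (hprim v hv), Set.inter_self]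
      by_contra hx
      exact hne (congrArg ray (eq_of_mem_ray_of_mem_ray (hprim u hu) (hprim v hv) hx hxE hxF))
    balanced := by
      rw [hsupp]
      intro E₀ hE₀ V hV
      obtain ⟨rfl, hfilter⟩ := hvert E₀ hE₀ V hV
      have hends : ∀ u ∈ D.support, ∑ v ∈ ends (ray u), v = u := fun u hu => by
        rw [(isEdgeParam_ray (hprim u hu)).ends_ray, Finset.sum_singleton]
      -- A ray has a single end, so this sum recovers the direction from the point set.
      refine ⟨fun E => ∑ u ∈ ends E, u, ?_, ?_⟩
      · intro E hE _
        obtain ⟨u, hu, rfl⟩ := Finset.mem_image.1 hE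
        dsimp only
        rw [hends u hu]
        refine ⟨hprim u hu, 1, one_pos, ?_⟩
        exact ⟨1, by simp, rfl⟩
      · convert hbal using 1
        rw [Finset.filter_congr_decidable, hfilter, Finset.sum_image hinj]
        refine Finset.sum_congr rfl fun u hu => ?_
        dsimp only
        rw [hends u hu, Finsupp.mapDomain_apply' _ D subset_rfl hinj hu]
    trivalent := by
      rw [hsupp]
      intro E₀ hE₀ V hV
      obtain ⟨-, hfilter⟩ := hvert E₀ hE₀ V hV
      rw [Finset.filter_congr_decidable, hfilter, Finset.card_image_of_injOn hinj]
      exact hcard }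

lemma extremePoints_line {u : ℤ × ℤ} (hu : IsPrimitiveVec u) : (line u).extremePoints ℝ = ∅ := by
  rw [Set.eq_empty_iff_forall_notMem]
  intro x hx
  obtain ⟨t, ht, rfl⟩ := (isEdgeParam_line hu).mem_iff.1 hx.1
  have := (isEdgeParam_line hu).mem_extremePoints_iff.1 hx
  simp at this

/-- A line with a weight. -/
noncomputable def lineCurve (u : ℤ × ℤ) (hu : IsPrimitiveVec u) (d : ℕ) (hd : d ≠ 0) :
    TropicalCurve := by
  have hsupp : (Finsupp.single (line u) d).support = {line u} := Finsupp.support_single _ hd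
  exact
  { wt := Finsupp.single (line u) d
    nonempty := by rw [hsupp]; exact Finset.singleton_nonempty _
    isEdge := by
      rw [hsupp]
      intro E hE
      rw [Finset.mem_singleton.1 hE]
      exact (isEdgeParam_line hu).isRationalEdge
    inter_subset := by
      rw [hsupp]
      intro E hE F hF hne
      rw [Finset.mem_singleton.1 hE, Finset.mem_singleton.1 hF] at hne
      exact absurd rfl hne
    balanced := by
      rw [hsupp]
      intro E hE V hV
      rw [Finset.mem_singleton.1 hE, extremePoints_line hu] at hV
      exact hV.elim
    trivalent := by
      rw [hsupp]
      intro E hE V hV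
      rw [Finset.mem_singleton.1 hE, extremePoints_line hu] at hV
      exact hV.elim }

open scoped Classical in
/-- There is a curve which is the union of the rays from the origin with given balanced weights. -/
lemma exists_fan (D : (ℤ × ℤ) →₀ ℕ) (hprim : ∀ u ∈ D.support, IsPrimitiveVec u) (hD : D ≠ 0)
    (hbal : (D.sum fun u d => d • u) = 0) :
    ∃ F : TropicalCurve, {x : Plane | ∑ E ∈ F.edges with x ∈ E, F.wt E ≠
      D.sum fun u d => d • (if x ∈ ray u then 1 else 0)}.Finite := by
  by_cases hcard : 3 ≤ D.support.card
  · refine ⟨fan D hprim hbal hcard, ?_⟩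
    convert Set.finite_empty
    rw [Set.eq_empty_iff_forall_notMem]
    intro x hx
    apply hx
    have hinj : Set.InjOn ray (D.support : Set (ℤ × ℤ)) := injOn_ray hprim
    have hedges : (fan D hprim hbal hcard).edges = D.support.image ray :=
      Finsupp.mapDomain_support_of_injOn D hinj
    rw [hedges, Finset.sum_filter, Finset.sum_image hinj]
    refine Finset.sum_congr rfl fun u hu => ?_
    have hwt : (fan D hprim hbal hcard).wt (ray u) = D u :=
      Finsupp.mapDomain_apply' _ D subset_rfl hinj hu
    rw [hwt]
    by_cases hxu : x ∈ ray u <;> simp [hxu]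
  -- With at most two directions, balancing leaves two opposite rays of equal weight. The origin
  -- would be a bivalent vertex, so the curve has to be a line.
  · obtain ⟨u, hu⟩ := Finsupp.support_nonempty_iff.2 hD
    have hu0 := Finsupp.mem_support_iff.1 hu
    have hpu := hprim u hu
    obtain ⟨hneg, hwt⟩ : D.support = {u, -u} ∧ D (-u) = D u := by
      rw [Finsupp.sum, ← Finset.add_sum_erase _ _ hu] at hbal
      have hle : (D.support.erase u).card ≤ 1 := by
        rw [Finset.card_erase_of_mem hu]; omega
      rcases Finset.card_le_one_iff_subset_singleton.1 hle with ⟨v, hv⟩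
      rcases Finset.subset_singleton_iff.1 hv with he | he
      · rw [he, Finset.sum_empty, add_zero] at hbal
        rcases smul_eq_zero.1 hbal with h | h
        · exact absurd h hu0
        · exact absurd h hpu.ne_zero
      · rw [he, Finset.sum_singleton] at hbal
        have hvs : v ∈ D.support := Finset.mem_of_mem_erase (by rw [he]; simp)
        have hv0 := Finsupp.mem_support_iff.1 hvs
        have h1 : (D u : ℝ) • latticeVec u = (D v : ℝ) • latticeVec (-v) := by
          rw [latticeVec_neg, smul_neg, ← latticeVec_nsmul, ← latticeVec_nsmul,
            eq_neg_iff_add_eq_zero, ← latticeVec_add, hbal, latticeVec_zero]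
        have h2 : u = -v := hpu.eq_of_smul (hprim v hvs).neg
          (by exact_mod_cast Nat.pos_of_ne_zero hu0) (by exact_mod_cast Nat.pos_of_ne_zero hv0) h1
        have h3 : v = -u := by rw [h2, neg_neg]
        subst h3
        rw [neg_neg] at h1
        refine ⟨?_, ?_⟩
        · rw [← Finset.insert_erase hu, he]
        · exact_mod_cast (smul_left_injective ℝ hpu.latticeVec_ne_zero h1).symm
    -- The two rays share the origin, which the line counts only once; it is the only exceptional
    -- point.
    refine ⟨lineCurve u hpu (D u) hu0, (Set.finite_singleton (0 : Plane)).subset ?_⟩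
    intro x hx
    by_contra hx0
    rw [Set.mem_singleton_iff] at hx0
    apply hx
    have hedges : (lineCurve u hpu (D u) hu0).edges = {line u} := Finsupp.support_single _ hu0
    have hw : (lineCurve u hpu (D u) hu0).wt (line u) = D u := Finsupp.single_eq_same
    rw [hedges, Finset.sum_filter, Finset.sum_singleton, hw, Finsupp.sum, hneg,
      Finset.sum_pair hpu.ne_neg, hwt, mem_line_iff]
    by_cases h1 : x ∈ ray u
    · have h2 : x ∉ ray (-u) := fun h2 =>
        hpu.ne_neg (eq_of_mem_ray_of_mem_ray hpu hpu.neg hx0 h1 h2)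
      simp [h1, h2]
    · by_cases h2 : x ∈ ray (-u) <;> simp [h1, h2]

/-! ### Homotheties -/

/-- The homothety with positive ratio `t`, as an automorphism of the plane. -/
noncomputable def homothety (t : ℝ) (ht : t ≠ 0) : Plane ≃ₗ[ℝ] Plane :=
  LinearEquiv.smulOfNeZero ℝ Plane t ht

lemma homothety_apply (t : ℝ) (ht : t ≠ 0) (x : Plane) : homothety t ht x = t • x := rfl

lemma IsEdgeParam.image_homothety {E : Set Plane} {P : Plane} {u : ℤ × ℤ} {I : Set ℝ}
    (h : IsEdgeParam E P u I) {t : ℝ} (ht : 0 < t) :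
    IsEdgeParam (homothety t ht.ne' '' E) (t • P) u ((fun s => t * s) '' I) := by
  refine ⟨h.prim, ?_, ?_⟩
  · rcases h.dom with ⟨l, hl, rfl⟩ | rfl | rfl
    · exact Or.inl ⟨t * l, mul_pos ht hl, by
        rw [Set.image_mul_left_Icc ht.le hl.le, mul_zero]⟩
    · right; left
      rw [Set.image_mul_left_Ici ht, mul_zero]
    · right; right
      exact Set.image_univ_of_surjective (mul_left_surjective₀ ht.ne')
  · rw [h.eq, Set.image_image, Set.image_image]
    refine Set.image_congr fun s _ => ?_
    rw [homothety_apply, smul_add, smul_smul]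

/-- The image of a curve under a homothety. -/
noncomputable def dilate (L : TropicalCurve) (t : ℝ) (ht : 0 < t) : TropicalCurve := by
  classical
  have hinj : Function.Injective (fun E : Set Plane => homothety t ht.ne' '' E) :=
    Set.image_injective.2 (homothety t ht.ne').injective
  have hsupp : (L.wt.mapDomain fun E => homothety t ht.ne' '' E).support =
      L.wt.support.image fun E => homothety t ht.ne' '' E :=
    Finsupp.mapDomain_support_of_injective hinj _
  have hext : ∀ E : Set Plane, (homothety t ht.ne' '' E).extremePoints ℝ =
      homothety t ht.ne' '' E.extremePoints ℝ := fun E => (image_extremePoints _ _).symm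
  have hmem : ∀ (x : Plane) (E : Set Plane), homothety t ht.ne' x ∈ homothety t ht.ne' '' E ↔
      x ∈ E := fun x E => (homothety t ht.ne').injective.mem_set_image
  exact
  { wt := L.wt.mapDomain fun E => homothety t ht.ne' '' E
    nonempty := by rw [hsupp]; exact L.nonempty.image _
    isEdge := by
      rw [hsupp]
      intro E hE
      obtain ⟨E, hE', rfl⟩ := Finset.mem_image.1 hE
      obtain ⟨P, u, I, h⟩ := (L.isEdge E hE').exists_param
      exact (h.image_homothety ht).isRationalEdge
    inter_subset := by
      rw [hsupp]
      intro E hE F hF hne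
      obtain ⟨E, hE', rfl⟩ := Finset.mem_image.1 hE
      obtain ⟨F, hF', rfl⟩ := Finset.mem_image.1 hF
      rw [hext, hext, ← Set.image_inter (homothety t ht.ne').injective,
        ← Set.image_inter (homothety t ht.ne').injective]
      exact Set.image_mono (L.inter_subset E hE' F hF' fun h => hne (by rw [h]))
    balanced := by
      rw [hsupp]
      intro E hE V hV
      obtain ⟨E, hE', rfl⟩ := Finset.mem_image.1 hE
      rw [hext] at hV
      obtain ⟨V, hV, rfl⟩ := hV
      obtain ⟨u, hu, hsum⟩ := L.balanced E hE' V hV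
      have hpre : ∀ F : Set Plane, homothety t ht.ne' ⁻¹' (homothety t ht.ne' '' F) = F :=
        fun F => Set.preimage_image_eq F (homothety t ht.ne').injective
      -- A homothety of positive ratio preserves directions, so the primitive vectors of the
      -- original edges serve again.
      refine ⟨fun F => u (homothety t ht.ne' ⁻¹' F), ?_, ?_⟩
      · intro F hF hVF
        obtain ⟨F, hF', rfl⟩ := Finset.mem_image.1 hF
        dsimp only
        rw [hpre]
        obtain ⟨hp, s, hs, hsF⟩ := hu F hF' ((hmem V F).1 hVF)
        refine ⟨hp, t * s, mul_pos ht hs, _, hsF, ?_⟩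
        rw [homothety_apply, homothety_apply, smul_add, smul_smul]
      · rw [Finset.filter_image, Finset.sum_image hinj.injOn]
        simpa only [hmem, hpre, Finsupp.mapDomain_apply hinj] using hsum
    trivalent := by
      rw [hsupp]
      intro E hE V hV
      obtain ⟨E, hE', rfl⟩ := Finset.mem_image.1 hE
      rw [hext] at hV
      obtain ⟨V, hV, rfl⟩ := hV
      have := L.trivalent E hE' V hV
      rw [Finset.filter_image, Finset.card_image_of_injective _ hinj]
      simpa only [hmem] using this }

end TropicalCurve

namespace TropicalCurve

/-! ### Contraction of a curve to a fan -/

open scoped Classical in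
/-- A point from which the edge is parametrized. -/
noncomputable def basePoint (E : Set Plane) : Plane :=
  if h : IsRationalEdge E then h.exists_param.choose else 0

lemma exists_param_basePoint {E : Set Plane} (h : IsRationalEdge E) :
    ∃ u I, IsEdgeParam E (basePoint E) u I := by
  rw [basePoint, dif_pos h]
  exact h.exists_param.choose_spec

open scoped Classical in
/-- The point which moves like `x` under a homothety that is applied to the bounded edges only. -/
noncomputable def anchor (E : Set Plane) (x : Plane) : Plane :=
  if Bornology.IsBounded E then x else basePoint E

lemma not_isBounded_of_mem_endSet {E : Set Plane} {u : ℤ × ℤ} (hu : u ∈ endSet E) :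
    ¬ Bornology.IsBounded E := by
  intro h
  rw [endSet_eq_empty_of_isBounded h] at hu
  exact hu

/-- A ray is parametrized from its endpoint, so that `basePoint` is this endpoint. Hence the anchors
of all edges at a vertex agree. -/
lemma anchor_of_mem_extremePoints {E : Set Plane} (h : IsRationalEdge E) {x : Plane}
    (hx : x ∈ E.extremePoints ℝ) : anchor E x = x := by
  unfold anchor
  split_ifs with hb
  · rfl
  · obtain ⟨u, I, hI⟩ := exists_param_basePoint h
    obtain ⟨t, -, rfl⟩ := hI.mem_iff.1 hx.1
    have ht := hI.mem_extremePoints_iff.1 hx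
    rcases hI.dom with ⟨l, hl, rfl⟩ | rfl | rfl
    · exact absurd hI.isBounded hb
    · rw [interior_Ici, Set.Ici_sdiff_Ioi_same] at ht
      rw [Set.mem_singleton_iff.1 ht, zero_smul, add_zero]
    · simp at ht

/-- The deformation of a curve which multiplies the bounded edges by `t`. -/
noncomputable def contraction (L : TropicalCurve) (t : ℝ) (x : ↥L.carrier) : Plane :=
  (x : Plane) + (t - 1) • anchor x.2.choose x

variable {L : TropicalCurve}

/-- The chosen edge in the definition is immaterial: two different edges through `x` have it as a
common endpoint, and both anchors are then `x`. -/
lemma contraction_apply (t : ℝ) {x : ↥L.carrier} {E : Set Plane} (hE : E ∈ L.edges)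
    (hx : (x : Plane) ∈ E) : L.contraction t x = x + (t - 1) • anchor E x := by
  obtain ⟨hF, hxF⟩ := x.2.choose_spec
  unfold contraction
  by_cases h : E = x.2.choose
  · rw [← h]
  · obtain ⟨h1, h2⟩ := L.inter_subset E hE _ hF h ⟨hx, hxF⟩
    rw [anchor_of_mem_extremePoints (L.isEdge E hE) h1,
      anchor_of_mem_extremePoints (L.isEdge _ hF) h2]

lemma contraction_mem_closedCone {t : ℝ} (ht : 0 ≤ t) : L.contraction t ∈ L.closedCone := by
  intro E hE
  by_cases hb : Bornology.IsBounded E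
  · refine ⟨t, ht, fun h => absurd hb h, fun x y hx hy => ?_⟩
    rw [contraction_apply t hE hx, contraction_apply t hE hy, anchor, anchor, if_pos hb, if_pos hb]
    module
  · refine ⟨1, zero_le_one, fun _ => rfl, fun x y hx hy => ?_⟩
    rw [contraction_apply t hE hx, contraction_apply t hE hy, anchor, anchor, if_neg hb, if_neg hb]
    module

lemma mem_edgeImage_contraction {t : ℝ} {E : Set Plane} (hE : E ∈ L.edges) {y : Plane} :
    y ∈ L.edgeImage (L.contraction t) E ↔ ∃ x ∈ E, x + (t - 1) • anchor E x = y := by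
  constructor
  · rintro ⟨x, hx, rfl⟩
    exact ⟨x, hx, (contraction_apply t hE hx).symm⟩
  · rintro ⟨x, hx, rfl⟩
    exact ⟨⟨x, mem_carrier hE hx⟩, hx, contraction_apply t hE hx⟩

lemma edgeImage_contraction_of_isBounded (t : ℝ) {E : Set Plane} (hE : E ∈ L.edges)
    (hb : Bornology.IsBounded E) :
    L.edgeImage (L.contraction t) E = (fun x => t • x) '' E := by
  ext y
  rw [mem_edgeImage_contraction hE]
  simp only [anchor, if_pos hb, Set.mem_image]
  refine exists_congr fun x => and_congr_right fun _ => ?_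
  rw [show x + (t - 1) • x = t • x by module]

lemma edgeImage_contraction_of_not_isBounded (t : ℝ) {E : Set Plane} (hE : E ∈ L.edges)
    (hb : ¬ Bornology.IsBounded E) {u : ℤ × ℤ} {I : Set ℝ} (h : IsEdgeParam E (basePoint E) u I) :
    L.edgeImage (L.contraction t) E =
      (fun s : ℝ => t • basePoint E + s • latticeVec u) '' I := by
  ext y
  rw [mem_edgeImage_contraction hE]
  simp only [anchor, if_neg hb]
  constructor
  · rintro ⟨x, hx, rfl⟩
    obtain ⟨s, hs, rfl⟩ := h.mem_iff.1 hx
    exact ⟨s, hs, by module⟩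
  · rintro ⟨s, hs, rfl⟩
    exact ⟨_, h.mem hs, by module⟩

/-- On a ray or line the contraction is a translation and not the homothety, but the image sets
agree because scaling maps `[0, ∞)` and `ℝ` onto themselves. -/
lemma edgeImage_contraction_of_pos {t : ℝ} (ht : 0 < t) {E : Set Plane} (hE : E ∈ L.edges) :
    L.edgeImage (L.contraction t) E = homothety t ht.ne' '' E := by
  by_cases hb : Bornology.IsBounded E
  · exact edgeImage_contraction_of_isBounded t hE hb
  · obtain ⟨u, I, h⟩ := exists_param_basePoint (L.isEdge E hE)
    rw [edgeImage_contraction_of_not_isBounded t hE hb h, (h.image_homothety ht).eq]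
    rcases h.dom with ⟨l, hl, rfl⟩ | rfl | rfl
    · exact absurd h.isBounded hb
    · rw [Set.image_mul_left_Ici ht, mul_zero]
    · rw [Set.image_univ_of_surjective (mul_left_surjective₀ ht.ne')]

lemma isImage_contraction_of_pos (L : TropicalCurve) {t : ℝ} (ht : 0 < t) :
    L.IsImage (L.contraction t) (L.dilate t ht) := by
  classical
  unfold IsImage
  convert Set.finite_empty
  rw [Set.eq_empty_iff_forall_notMem]
  intro x hx
  apply hx
  have hinj : Function.Injective (fun E : Set Plane => homothety t ht.ne' '' E) :=
    Set.image_injective.2 (homothety t ht.ne').injective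
  have hedges : (L.dilate t ht).edges = L.edges.image fun E => homothety t ht.ne' '' E :=
    (Finsupp.mapDomain_support_of_injective hinj L.wt).trans (by rw [edges])
  have hwt : ∀ E, (L.dilate t ht).wt (homothety t ht.ne' '' E) = L.wt E :=
    fun E => Finsupp.mapDomain_apply hinj _ _
  rw [Finset.sum_filter, Finset.sum_filter, hedges, Finset.sum_image hinj.injOn]
  refine Finset.sum_congr rfl fun E hE => ?_
  rw [hwt, edgeImage_contraction_of_pos ht hE]

lemma dilate_one (L : TropicalCurve) : L.dilate 1 one_pos = L := by
  apply TropicalCurve.ext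
  have : (fun E : Set Plane => homothety 1 (one_pos (α := ℝ)).ne' '' E) = id := by
    funext E
    exact (Set.image_congr fun x _ => one_smul ℝ x).trans (Set.image_id E)
  change L.wt.mapDomain (fun E : Set Plane => homothety 1 (one_pos (α := ℝ)).ne' '' E) = L.wt
  rw [this, Finsupp.mapDomain_id]

-- At `t = 0` bounded edges collapse to the origin, and rays and lines move to the origin. Away from
-- it a line is the disjoint union of two rays, which matches its two ends.
open scoped Classical in
lemma sum_ends_mem_ray {E : Set Plane} (hE : E ∈ L.edges) {x : Plane} (hx : x ≠ 0) :
    ∑ u ∈ ends E, (if x ∈ ray u then 1 else 0 : ℕ) =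
      if x ∈ L.edgeImage (L.contraction 0) E then 1 else 0 := by
  obtain ⟨u, I, h⟩ := exists_param_basePoint (L.isEdge E hE)
  rcases h.dom with ⟨l, hl, rfl⟩ | rfl | rfl
  · rw [h.ends_segment, edgeImage_contraction_of_isBounded 0 hE h.isBounded, if_neg]
    · simp
    · rintro ⟨y, -, rfl⟩
      simp at hx
  · have hb := not_isBounded_of_mem_endSet (E := E) (u := u) (by rw [h.endSet_ray]; rfl)
    rw [h.ends_ray, edgeImage_contraction_of_not_isBounded 0 hE hb h, Finset.sum_singleton,
      zero_smul]
    rfl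
  · have hb := not_isBounded_of_mem_endSet (E := E) (u := u) (by rw [h.endSet_line]; simp)
    rw [h.ends_line, edgeImage_contraction_of_not_isBounded 0 hE hb h,
      Finset.sum_pair h.prim.ne_neg, zero_smul]
    change _ = if x ∈ line u then 1 else 0
    rw [mem_line_iff]
    by_cases h1 : x ∈ ray u
    · have h2 : x ∉ ray (-u) := fun h2 =>
        h.prim.ne_neg (eq_of_mem_ray_of_mem_ray h.prim h.prim.neg hx h1 h2)
      simp [h1, h2]
    · by_cases h2 : x ∈ ray (-u) <;> simp [h1, h2]

open scoped Classical in
lemma isImage_contraction_zero (L F : TropicalCurve)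
    (hF : {x : Plane | ∑ E ∈ F.edges with x ∈ E, F.wt E ≠
      L.endWeight.sum fun u d => d • (if x ∈ ray u then 1 else 0)}.Finite) :
    L.IsImage (L.contraction 0) F := by
  unfold IsImage
  refine (hF.union (Set.finite_singleton (0 : Plane))).subset ?_
  intro x hx
  by_cases hx0 : x = 0
  · exact Or.inr hx0
  · left
    rw [Set.mem_ofPred_eq] at hx ⊢
    rw [endWeight_sum]
    convert hx using 1
    rw [Finset.sum_filter]
    refine Finset.sum_congr rfl fun E hE => ?_
    rw [← Finset.smul_sum, sum_ends_mem_ray hE hx0]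
    split_ifs <;> simp

/-! ### The path from a curve to its fan -/

lemma continuous_curve (L : TropicalCurve) : Continuous (Cell.curve (L := L)) :=
  continuous_def.2 fun _ hS => isOpen_iff.1 hS L

open scoped Classical in
/-- A curve is connected to the fan with the same asymptotic directions. -/
lemma connectedComponent_eq_of_fan (L F : TropicalCurve)
    (hF : {x : Plane | ∑ E ∈ F.edges with x ∈ E, F.wt E ≠
      L.endWeight.sum fun u d => d • (if x ∈ ray u then 1 else 0)}.Finite) :
    connectedComponent L = connectedComponent F := by
  have himage : ∀ t : unitInterval, L.IsImage (L.contraction t)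
      (if ht : 0 < (t : ℝ) then L.dilate t ht else F) := by
    intro t
    split_ifs with ht
    · exact L.isImage_contraction_of_pos ht
    · rw [le_antisymm (not_lt.1 ht) t.2.1]
      exact isImage_contraction_zero L F hF
  -- The curve is a homothetic copy of `L` for `t > 0` and is replaced by `F` at `t = 0`. The
  -- topology of the cell sees only the parameter, so no continuity of the second component has to
  -- be checked.
  let γ : unitInterval → L.Cell := fun t =>
    ⟨(L.contraction t, if ht : 0 < (t : ℝ) then L.dilate t ht else F),
      contraction_mem_closedCone t.2.1, himage t⟩
  have hγ : Continuous γ := by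
    rw [continuous_induced_rng]
    refine continuous_pi fun x => ?_
    change Continuous fun t : unitInterval => (x : Plane) + ((t : ℝ) - 1) • anchor x.2.choose x
    fun_prop
  have hpre : IsPreconnected (Set.range fun t => (γ t).curve) :=
    isPreconnected_range ((continuous_curve L).comp hγ)
  have h1 : L ∈ Set.range fun t => (γ t).curve := by
    refine ⟨1, ?_⟩
    change (if ht : 0 < ((1 : unitInterval) : ℝ) then L.dilate _ ht else F) = L
    rw [dif_pos (by simp)]
    exact L.dilate_one
  have h0 : F ∈ Set.range fun t => (γ t).curve := by
    refine ⟨0, ?_⟩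
    change (if ht : 0 < ((0 : unitInterval) : ℝ) then L.dilate _ ht else F) = F
    rw [dif_neg (by simp)]
  exact connectedComponent_eq (hpre.subset_connectedComponent h1 h0)

/-- Both curves contract to one and the same fan. -/
lemma connectedComponent_eq_of_endWeight_eq {L L' : TropicalCurve}
    (h : L.endWeight = L'.endWeight) : connectedComponent L = connectedComponent L' := by
  obtain ⟨F, hF⟩ := exists_fan L.endWeight (fun _ => L.isPrimitiveVec_of_mem_support)
    L.endWeight_ne_zero L.endWeight_balanced
  rw [connectedComponent_eq_of_fan L F hF, connectedComponent_eq_of_fan L' F (h ▸ hF)]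

end TropicalCurve

/-- Two tropical plane curves lie in the same connected component of the space of all tropical plane
curves if and only if they have the same Newton polygon. -/
theorem corollary4p2 (L L' : TropicalCurve) :
    connectedComponent L = connectedComponent L' ↔ L.SameNewtonPolygon L' :=
  ⟨fun h => TropicalCurve.sameNewtonPolygon_of_endWeight_eq
      (TropicalCurve.endWeight_eq_of_connectedComponent_eq h).symm,
    fun h => TropicalCurve.connectedComponent_eq_of_endWeight_eq h.endWeight_eq⟩
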